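/- Let $\Lambda$ and $\Delta$ be commutative local uniserial rings (i.e. local rings whose ideals form a chain) of the same finite length $n$, with residue fields isomorphic to a field $k$. For such a ring $\Lambda$ with maximal ideal $\operatorname{rad}\Lambda$, let $\mathcal S_2(\Lambda)$ be the category whose objects are the pairs $(B;A)$ of a finitely generated $\Lambda$-module $B$ and a submodule $A\subseteq B$ with $(\operatorname{rad}\Lambda)^2A=0$, and whose morphisms $(B;A)\to(D;C)$ are the $\Lambda$-linear maps $f:B\to D$ with $f(A)\subseteq C$. Put $A^-=\operatorname{rad}A=(\operatorname{rad}\Lambda)A$ and $A^+=A+\operatorname{soc}B$, and let $\mathcal N_\Lambda$ be the categorical ideal of $\mathcal S_2(\Lambda)$ consisting of the morphisms $f:(B;A)\to(D;C)$ with $f(A^+)\subseteq C^-$. Let $\mathcal P_n$ be the poset that is the disjoint union of the chain $n-1<\dots<2<1$ and two further points $1'$, $1''$, each comparable only to itself. Let $\operatorname{rep}'_k\mathcal P_n$ be the category of finite-dimensional $k$-vector spaces $V^0$ with subspaces $V^i\subseteq V^0$ for $i\in\mathcal P_n$, such that $V^i\subseteq V^j$ whenever $i<j$ in $\mathcal P_n$,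 and such that $V^{n-1}\subseteq V^{1'}$ and $V^{1'}+V^{1''}=V^0$ (for $n=1$, $V^{n-1}$ is the total space $V^0$); morphisms are the linear maps of total spaces respecting all the subspaces. Then the factor categories $\mathcal S_2(\Lambda)/\mathcal N_\Lambda$ and $\mathcal S_2(\Delta)/\mathcal N_\Delta$ are both equivalent to $\operatorname{rep}'_k\mathcal P_n$, and hence equivalent to each other, all by additive equivalences. For example, for every prime $p$ and every $n\ge 1$, the categories $\mathcal S_2(\mathbb Z/p^n)/\mathcal N$ and $\mathcal S_2(\mathbb F_p[T]/(T^n))/\mathcal N$ are equivalent. -/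

import Mathlib

open CategoryTheory

universe u v w w'

/-- A module is uniserial if its submodules form a chain. -/
def IsUniserialModule (R : Type u) (M : Type v) [Ring R] [AddCommGroup M] [Module R M] : Prop :=
  ∀ N N' : Submodule R M, N ≤ N' ∨ N' ≤ N

/-- A commutative ring is uniserial if its ideals form a chain. -/
def IsUniserialRing (R : Type u) [CommRing R] : Prop :=
  IsUniserialModule R R

/-! ### Pairs `(B; A)` of a finitely generated module and a submodule -/

section Pairs

/-- An object `(B; A)` of the category `𝒮(Λ)`: a finitely generated `Λ`-module `B` together with a
submodule `A`. -/
structure SubmodulePair (Λ : Type u) [CommRing Λ] : Type (u + 1) where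
  B : Type u
  [addCommGroup : AddCommGroup B]
  [module : Module Λ B]
  [finite : Module.Finite Λ B]
  A : Submodule Λ B

attribute [instance] SubmodulePair.addCommGroup SubmodulePair.module SubmodulePair.finite

namespace SubmodulePair

variable {Λ : Type u} [CommRing Λ]

/-- The `Λ`-linear maps `f : B → D` such that `f(A) ⊆ C`. -/
def homs (X Y : SubmodulePair Λ) : Submodule Λ (X.B →ₗ[Λ] Y.B) where
  carrier := {f | ∀ a ∈ X.A, f a ∈ Y.A}
  add_mem' hf hg a ha := Y.A.add_mem (hf a ha) (hg a ha)
  zero_mem' _ _ := Y.A.zero_mem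
  smul_mem' c _ hf a ha := Y.A.smul_mem c (hf a ha)

instance : Category.{u} (SubmodulePair Λ) where
  Hom X Y := homs X Y
  id X := ⟨LinearMap.id, fun _ ha => ha⟩
  comp f g := ⟨g.1 ∘ₗ f.1, fun a ha => g.2 _ (f.2 a ha)⟩

/-- The linear map `B → D` underlying a morphism `(B; A) → (D; C)`. -/
def toLin {X Y : SubmodulePair Λ} (f : X ⟶ Y) : X.B →ₗ[Λ] Y.B := f.1

instance : Preadditive (SubmodulePair Λ) where
  homGroup X Y := inferInstanceAs (AddCommGroup (homs X Y))
  add_comp _ _ _ f f' g := Subtype.ext (LinearMap.comp_add f.1 f'.1 g.1)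
  comp_add _ _ _ f g g' := Subtype.ext (LinearMap.add_comp f.1 g'.1 g.1)

/-- `A⁻ = rad A`. -/
def Aminus (X : SubmodulePair Λ) : Submodule Λ X.B := Ring.jacobson Λ • X.A

/-- `soc B`: for a local ring `Λ`, the largest semisimple submodule of `B` consists of the elements
that are annihilated by `rad Λ`. -/
def soc (X : SubmodulePair Λ) : Submodule Λ X.B :=
  Submodule.torsionBySet Λ X.B (Ring.jacobson Λ : Set Λ)

/-- `A⁺ = A + soc B`. -/
def Aplus (X : SubmodulePair Λ) : Submodule Λ X.B := X.A ⊔ X.soc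

/-- The pairs `(B; A)` such that `(rad Λ)^m A = 0`. If `p` generates `rad Λ`, this says `p^m A = 0`. -/
def bounded (Λ : Type u) [CommRing Λ] (m : ℕ) : ObjectProperty (SubmodulePair Λ) :=
  fun X => (Ring.jacobson Λ) ^ m • X.A = ⊥

theorem map_mem_Aplus {X Y : SubmodulePair Λ} (f : X ⟶ Y) {b : X.B} (hb : b ∈ X.Aplus) :
    toLin f b ∈ Y.Aplus := by
  obtain ⟨a, ha, s, hs, rfl⟩ := Submodule.mem_sup.1 hb
  rw [map_add]
  refine Submodule.add_mem_sup (f.2 a ha) ?_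
  rw [soc, Submodule.mem_torsionBySet_iff] at hs ⊢
  intro c
  rw [← map_smul, hs c, map_zero]

theorem map_mem_Aminus {X Y : SubmodulePair Λ} (f : X ⟶ Y) {b : X.B} (hb : b ∈ X.Aminus) :
    toLin f b ∈ Y.Aminus := by
  have h : X.Aminus.map (toLin f) ≤ Y.Aminus := by
    rw [Aminus, Submodule.map_smul'']
    refine Submodule.smul_mono le_rfl ?_
    rintro _ ⟨a, ha, rfl⟩
    exact f.2 a ha
  exact h ⟨b, hb, rfl⟩

end SubmodulePair

/-- The category `𝒮_m(Λ)`. -/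
abbrev BoundedPair (Λ : Type u) [CommRing Λ] (m : ℕ) : Type (u + 1) :=
  (SubmodulePair.bounded Λ m).FullSubcategory

namespace BoundedPair

variable {Λ : Type u} [CommRing Λ]

/-- The categorical ideal `𝒩` of `𝒮₂(Λ)`: the subgroup of the morphisms `f : (B; A) → (D; C)` such
that `f(A⁺) ⊆ C⁻`. -/
def idealN (X Y : BoundedPair Λ 2) : AddSubgroup (X ⟶ Y) where
  carrier := {f | ∀ b ∈ X.obj.Aplus, SubmodulePair.toLin f.hom b ∈ Y.obj.Aminus}
  add_mem' hf hg b hb := Y.obj.Aminus.add_mem (hf b hb) (hg b hb)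
  zero_mem' _ _ := Y.obj.Aminus.zero_mem
  neg_mem' hf b hb := Y.obj.Aminus.neg_mem (hf b hb)

theorem comp_mem_idealN_left {X Y Z : BoundedPair Λ 2} (f : X ⟶ Y) {g : Y ⟶ Z}
    (hg : g ∈ idealN Y Z) : f ≫ g ∈ idealN X Z :=
  fun _ hb => hg _ (SubmodulePair.map_mem_Aplus f.hom hb)

theorem comp_mem_idealN_right {X Y Z : BoundedPair Λ 2} {f : X ⟶ Y} (g : Y ⟶ Z)
    (hf : f ∈ idealN X Y) : f ≫ g ∈ idealN X Z :=
  fun b hb => SubmodulePair.map_mem_Aminus g.hom (hf b hb)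

/-- Two parallel morphisms of `𝒮₂(Λ)` are congruent if their difference lies in `𝒩`. -/
def relN (Λ : Type u) [CommRing Λ] : HomRel (BoundedPair Λ 2) :=
  fun X Y f g => f - g ∈ idealN X Y

instance : Congruence (relN Λ) where
  equivalence {X Y} :=
    { refl := fun f => by
        change f - f ∈ idealN X Y
        rw [sub_self]
        exact (idealN X Y).zero_mem
      symm := fun {f g} h => by
        change g - f ∈ idealN X Y
        rw [← neg_sub]
        exact (idealN X Y).neg_mem h
      trans := fun {f g k} h₁ h₂ => by
        change f - k ∈ idealN X Y
        rw [← sub_add_sub_cancel f g k]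
        exact (idealN X Y).add_mem h₁ h₂ }
  comp_left {X Y Z} f {g g'} h := by
    change f ≫ g - f ≫ g' ∈ idealN X Z
    rw [← Preadditive.comp_sub]
    exact comp_mem_idealN_left f h
  comp_right {X Y Z} {f f'} g h := by
    change f ≫ g - f' ≫ g ∈ idealN X Z
    rw [← Preadditive.sub_comp]
    exact comp_mem_idealN_right g h

theorem relN_add ⦃X Y : BoundedPair Λ 2⦄ (f₁ f₂ g₁ g₂ : X ⟶ Y) (hf : relN Λ f₁ f₂)
    (hg : relN Λ g₁ g₂) : relN Λ (f₁ + g₁) (f₂ + g₂) := by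
  change f₁ + g₁ - (f₂ + g₂) ∈ idealN X Y
  rw [add_sub_add_comm]
  exact (idealN X Y).add_mem hf hg

end BoundedPair

/-- The factor category `𝒮₂(Λ)/𝒩_Λ`. -/
abbrev S2ModN (Λ : Type u) [CommRing Λ] : Type (u + 1) :=
  CategoryTheory.Quotient (BoundedPair.relN Λ)

instance (Λ : Type u) [CommRing Λ] : Preadditive (S2ModN Λ) :=
  Quotient.preadditive (BoundedPair.relN Λ) BoundedPair.relN_add

end Pairs

/-! ### Representations of posets -/

section PosetRepresentations

/-- A finite dimensional `k`-linear representation of a poset `P`: a total space together with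
subspaces `Vⁱ`, `i ∈ P`, such that `Vⁱ ⊆ Vʲ` whenever `i ≤ j`. -/
structure PosetRep (k : Type u) [Field k] (P : Type v) [PartialOrder P] : Type (max (u + 1) v) where
  total : Type u
  [addCommGroup : AddCommGroup total]
  [module : Module k total]
  [finite : Module.Finite k total]
  sub : P →o Submodule k total

attribute [instance] PosetRep.addCommGroup PosetRep.module PosetRep.finite

namespace PosetRep

variable {k : Type u} [Field k] {P : Type v} [PartialOrder P]

/-- The linear maps between the total spaces that respect all the subspaces. -/
def homs (V W : PosetRep k P) : Submodule k (V.total →ₗ[k] W.total) where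
  carrier := {f | ∀ i, ∀ x ∈ V.sub i, f x ∈ W.sub i}
  add_mem' hf hg i x hx := (W.sub i).add_mem (hf i x hx) (hg i x hx)
  zero_mem' i _ _ := (W.sub i).zero_mem
  smul_mem' c _ hf i x hx := (W.sub i).smul_mem c (hf i x hx)

instance : Category.{u} (PosetRep k P) where
  Hom V W := homs V W
  id V := ⟨LinearMap.id, fun _ _ hx => hx⟩
  comp f g := ⟨g.1 ∘ₗ f.1, fun i x hx => g.2 i _ (f.2 i x hx)⟩

instance : Preadditive (PosetRep k P) where
  homGroup V W := inferInstanceAs (AddCommGroup (homs V W))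
  add_comp _ _ _ f f' g := Subtype.ext (LinearMap.comp_add f.1 f'.1 g.1)
  comp_add _ _ _ f g g' := Subtype.ext (LinearMap.add_comp f.1 g'.1 g.1)

end PosetRep

/-- The poset `𝒫_n`: the disjoint union of the chain `n - 1 < ⋯ < 2 < 1` and two further points
`1'` and `1''`, each of which is comparable only to itself. -/
abbrev PosetP (n : ℕ) : Type := (Set.Ico 1 n)ᵒᵈ ⊕ Unit ⊕ Unit

namespace PosetRep

variable {k : Type u} [Field k] {n : ℕ}

/-- The subspace `V^ℓ` for `1 ≤ ℓ ≤ n - 1`; for `ℓ = 0` this is the total space `V⁰`. -/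
def level (V : PosetRep k (PosetP n)) (ℓ : ℕ) : Submodule k V.total :=
  if h : ℓ ∈ Set.Ico 1 n then V.sub (Sum.inl (OrderDual.toDual ⟨ℓ, h⟩)) else ⊤

/-- The subspace `V' = V^{1'}`. -/
def prime (V : PosetRep k (PosetP n)) : Submodule k V.total := V.sub (Sum.inr (Sum.inl ()))

/-- The subspace `V'' = V^{1''}`. -/
def dprime (V : PosetRep k (PosetP n)) : Submodule k V.total := V.sub (Sum.inr (Sum.inr ()))

/-- The conditions `V^{n-1} ⊆ V'` and `V' + V'' = V⁰`. For `n = 1` the first one says `V' = V⁰`. -/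
def restricted (k : Type u) [Field k] (n : ℕ) : ObjectProperty (PosetRep k (PosetP n)) :=
  fun V => V.level (n - 1) ≤ V.prime ∧ V.prime ⊔ V.dprime = ⊤

end PosetRep

/-- The category `rep'_k 𝒫_n`. -/
abbrev RepPrime (k : Type u) [Field k] (n : ℕ) : Type (u + 1) :=
  (PosetRep.restricted k n).FullSubcategory

end PosetRepresentations

/-- Two preadditive categories are equivalent by means of an additive functor. -/
def AdditivelyEquivalent (C : Type u) [Category.{v} C] [Preadditive C]
    (D : Type w) [Category.{w'} D] [Preadditive D] : Prop :=
  ∃ e : C ≌ D, e.functor.Additive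

/-! In a local uniserial ring of length n the maximal ideal is (p) with p^n = 0 ≠ p^(n-1). Only this
and the map σ to k matter below, so both rings are compared with `RepPrime k n`.

The functor sends (B; A) to V⁰ = A⁺/A⁻, with V^l the image of A⁺ ∩ p^l B, V' = soc B/A⁻ and V'' =
A/A⁻. This is a k-space because pA⁺ = pA = A⁻, and A⁻ ⊆ soc B because p²A = 0. A morphism induces
zero exactly when it lies in 𝒩, whence faithfulness on the factor category (`repMap_eq_iff`).

Fullness (`exists_lift`) is an extension argument in the style of Kaplansky, with linear relations
between B and D that never lower heights. Height n forces an element to be zero, so such relations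
are single-valued. If G consists of the pairs in A⁺ × C⁺ matched by φ, then pG is such a relation;
it is enlarged one element at a time, inside G until its domain is A⁺, then freely up to B
(`exists_extension`).

For density (`exists_pair`), choose a basis of V⁰ adapted to the filtration and to V'. A basis
vector of level l becomes p^l times the generator of a cyclic module, of length l + 1 if the vector
is among those spanning V' and l + 2 otherwise; A is the part lying over V''. The condition V^{n-1}
⊆ V' ensures l + 2 ≤ n in the second case, and V' + V'' = V⁰ makes these vectors generate A⁺. -/

/-- A surjective ring homomorphism `σ : R → k` whose kernel is generated by a nilpotent element `p`
of nilpotency index `n`. -/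
structure IsUniformizer {R : Type u} [CommRing R] {k : Type w} [Field k] (σ : R →+* k) (p : R)
    (n : ℕ) : Prop where
  surjective : Function.Surjective σ
  map_eq_zero_iff : ∀ a, σ a = 0 ↔ p ∣ a
  pos : 0 < n
  pow_eq_zero : p ^ n = 0
  pow_pred_ne_zero : p ^ (n - 1) ≠ 0

/-! ### Divisibility by the uniformizer. -/

namespace IsUniformizer

variable {R : Type u} [CommRing R] {k : Type w} [Field k] {σ : R →+* k} {p : R} {n : ℕ}

theorem isUnit (h : IsUniformizer σ p n) {a : R} (ha : ¬ p ∣ a) : IsUnit a := by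
  rw [← h.map_eq_zero_iff] at ha
  obtain ⟨b, hb⟩ := h.surjective (σ a)⁻¹
  obtain ⟨c, hc⟩ := (h.map_eq_zero_iff (1 - a * b)).1 (by simp [hb, ha])
  have hn : IsNilpotent (1 - a * b) := ⟨n, by rw [hc, mul_pow, h.pow_eq_zero, zero_mul]⟩
  have := hn.isUnit_one_sub
  rw [sub_sub_cancel] at this
  exact isUnit_of_mul_isUnit_left this

theorem le_of_pow_eq_zero (h : IsUniformizer σ p n) {j : ℕ} (hj : p ^ j = 0) : n ≤ j := by
  by_contra! hlt
  exact h.pow_pred_ne_zero (pow_eq_zero_of_le (by omega) hj)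

theorem exists_eq_pow_mul (h : IsUniformizer σ p n) {a : R} (ha : a ≠ 0) :
    ∃ j u, IsUnit u ∧ a = p ^ j * u := by
  classical
  by_contra! hcon
  have key : ∀ j, p ^ j ∣ a := by
    intro j
    induction j with
    | zero => simp
    | succ j ih =>
      obtain ⟨b, rfl⟩ := ih
      by_cases hb : p ∣ b
      · rw [pow_succ]; exact mul_dvd_mul_left _ hb
      · exact absurd rfl (hcon j b (h.isUnit hb))
  have := key n
  rw [h.pow_eq_zero, zero_dvd_iff] at this
  exact ha this

/-- A nonzero a is p^l times a unit, so p^i a = 0 forces i + l ≥ n, hence l ≥ j. -/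
theorem pow_dvd_of_pow_mul_eq_zero (h : IsUniformizer σ p n) {i j : ℕ} (hij : i + j ≤ n) {a : R}
    (ha : p ^ i * a = 0) : p ^ j ∣ a := by
  rcases eq_or_ne a 0 with rfl | h0
  · exact dvd_zero _
  obtain ⟨l, u, hu, rfl⟩ := h.exists_eq_pow_mul h0
  rw [← mul_assoc, ← pow_add, hu.mul_left_eq_zero] at ha
  have := h.le_of_pow_eq_zero ha
  exact (pow_dvd_pow p (by omega)).mul_right u

theorem jacobson_eq (h : IsUniformizer σ p n) : Ring.jacobson R = Ideal.span {p} := by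
  have hker : RingHom.ker σ = Ideal.span {p} := by
    ext a
    rw [RingHom.mem_ker, h.map_eq_zero_iff, Ideal.mem_span_singleton]
  have : IsLocalRing R := by
    have : Nontrivial R := σ.domain_nontrivial
    refine IsLocalRing.of_nonunits_add fun a b ha hb hab => ?_
    have hp : ∀ c ∈ nonunits R, p ∣ c := fun c hc => by_contra fun h' => hc (h.isUnit h')
    have h0 := (h.map_eq_zero_iff _).2 (dvd_add (hp a ha) (hp b hb))
    exact (hab.map σ).ne_zero h0
  rw [IsLocalRing.ringJacobson_eq_maximalIdeal, ← hker]
  have := RingHom.ker_isMaximal_of_surjective σ h.surjective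
  exact (IsLocalRing.eq_maximalIdeal this).symm

end IsUniformizer

/-! ### Heights and height increasing relations. -/

section Height

variable {R : Type u} [CommRing R] (p : R) {B : Type v} [AddCommGroup B] [Module R B]
  {D : Type w} [AddCommGroup D] [Module R D]

/-- The submodule `p ^ l • B` of the elements of height at least `l`. -/
def heightGE (p : R) (B : Type v) [AddCommGroup B] [Module R B] (l : ℕ) : Submodule R B :=
  LinearMap.range (LinearMap.lsmul R B (p ^ l))

variable {p}

theorem mem_heightGE {l : ℕ} {x : B} : x ∈ heightGE p B l ↔ ∃ z, p ^ l • z = x := Iff.rfl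

theorem heightGE_zero : heightGE p B 0 = ⊤ :=
  eq_top_iff.2 fun x _ => ⟨x, by simp⟩

theorem heightGE_antitone : Antitone (heightGE p B) := by
  rintro l m hlm _ ⟨z, rfl⟩
  refine ⟨p ^ (m - l) • z, ?_⟩
  simp [smul_smul, ← pow_add, Nat.sub_add_cancel hlm]

theorem mem_heightGE_succ {l : ℕ} {x : B} :
    x ∈ heightGE p B (l + 1) ↔ ∃ z ∈ heightGE p B l, p • z = x := by
  constructor
  · rintro ⟨z, rfl⟩
    exact ⟨p ^ l • z, ⟨z, rfl⟩, by simp [smul_smul, pow_succ']⟩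
  · rintro ⟨_, ⟨z, rfl⟩, rfl⟩
    exact ⟨z, by simp [smul_smul, pow_succ']⟩

theorem map_mem_heightGE (f : B →ₗ[R] D) {l : ℕ} {x : B} (hx : x ∈ heightGE p B l) :
    f x ∈ heightGE p D l := by
  obtain ⟨z, rfl⟩ := hx
  exact ⟨f z, by simp⟩

/-- A linear relation that does not decrease heights. -/
def HeightIncreasing (p : R) (Γ : Submodule R (B × D)) : Prop :=
  ∀ z ∈ Γ, ∀ l, z.1 ∈ heightGE p B l → z.2 ∈ heightGE p D l

variable {k : Type w'} [Field k] {σ : R →+* k} {n : ℕ}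

theorem IsUniformizer.heightGE_eq_bot (h : IsUniformizer σ p n) : heightGE p B n = ⊥ := by
  rw [eq_bot_iff]
  rintro _ ⟨z, rfl⟩
  simp [h.pow_eq_zero]

/-- A height increasing relation extends to an element `x` of maximal height in its coset modulo the
domain. -/
theorem HeightIncreasing.sup_span (h : IsUniformizer σ p n) {Γ : Submodule R (B × D)}
    (hΓ : HeightIncreasing p Γ) {x : B} {y : D} {l : ℕ} (hxy : (p • x, p • y) ∈ Γ)
    (hx : x ∈ heightGE p B l) (hy : y ∈ heightGE p D l)
    (hmax : ∀ z ∈ Γ, x + z.1 ∉ heightGE p B (l + 1)) :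
    HeightIncreasing p (Γ ⊔ Submodule.span R {(x, y)}) := by
  intro z hz m hm
  obtain ⟨s, hs, _, ht, rfl⟩ := Submodule.mem_sup.1 hz
  obtain ⟨a, rfl⟩ := Submodule.mem_span_singleton.1 ht
  -- Multiples of (x, y) by p already lie in Γ. Otherwise a is a unit, and a height above l would
  -- contradict the maximality of x in its coset.
  by_cases ha : p ∣ a
  · obtain ⟨b, rfl⟩ := ha
    refine hΓ _ (Γ.add_mem hs ?_) m hm
    have : (p * b) • (x, y) = b • (p • x, p • y) := by simp [smul_smul, mul_comm]
    rw [this]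
    exact Γ.smul_mem b hxy
  · obtain ⟨a, rfl⟩ := h.isUnit ha
    have hml : m ≤ l := by
      by_contra! hlt
      refine hmax ((↑a⁻¹ : R) • s) (Γ.smul_mem _ hs) ?_
      have := heightGE_antitone (p := p) (B := B) (show l + 1 ≤ m from hlt)
        (Submodule.smul_mem _ (↑a⁻¹ : R) hm)
      simpa [smul_smul, add_comm] using this
    have hxm := heightGE_antitone (p := p) (B := B) hml hx
    have hym := heightGE_antitone (p := p) (B := D) hml hy
    have hsm : s.1 ∈ heightGE p B m := by
      have := Submodule.sub_mem _ hm (Submodule.smul_mem _ (a : R) hxm)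
      simpa using this
    exact Submodule.add_mem _ (hΓ s hs m hsm) (Submodule.smul_mem _ (a : R) hym)

/-- By the Noetherian condition a maximal such Γ exists. If its domain S missed part of T, some x in
T \ S with p • x in S could be chosen of maximal height in its coset; `step` supplies its image, and
`sup_span` contradicts maximality. G prescribes the allowed pairs, T the domain to be reached. -/
theorem HeightIncreasing.exists_extension [IsNoetherian R (B × D)] (h : IsUniformizer σ p n)
    {Γ₀ G : Submodule R (B × D)} {T : Submodule R B} (hΓ₀ : HeightIncreasing p Γ₀) (hle : Γ₀ ≤ G)
    (hT : ∀ z ∈ G, z.1 ∈ T)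
    (step : ∀ Γ, Γ₀ ≤ Γ → HeightIncreasing p Γ → ∀ x ∈ T, ∀ t, (p • x, t) ∈ Γ →
      ∀ l, x ∈ heightGE p B l → ∃ y ∈ heightGE p D l, (x, y) ∈ G ∧ p • y = t) :
    ∃ Γ, Γ₀ ≤ Γ ∧ Γ ≤ G ∧ HeightIncreasing p Γ ∧ ∀ x ∈ T, ∃ y, (x, y) ∈ Γ := by
  classical
  obtain ⟨Γ, ⟨h₁, h₂, h₃⟩, hmax⟩ := WellFounded.has_min
    (wellFounded_gt (α := Submodule R (B × D)))
    {Γ | Γ₀ ≤ Γ ∧ Γ ≤ G ∧ HeightIncreasing p Γ} ⟨Γ₀, le_rfl, hle, hΓ₀⟩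
  refine ⟨Γ, h₁, h₂, h₃, ?_⟩
  let S : Submodule R B := Γ.map (LinearMap.fst R B D)
  have memS : ∀ x, x ∈ S ↔ ∃ y, (x, y) ∈ Γ := by
    intro x
    constructor
    · rintro ⟨⟨a, b⟩, hz, rfl⟩; exact ⟨b, hz⟩
    · rintro ⟨y, hy⟩; exact ⟨_, hy, rfl⟩
  by_contra! hcon
  obtain ⟨x₀, hx₀T, hx₀⟩ := hcon
  replace hx₀ : x₀ ∉ S := fun hh => by
    obtain ⟨y, hy⟩ := (memS _).1 hh
    exact hx₀ y hy
  -- an element outside the domain whose multiple by `p` lies in the domain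
  obtain ⟨x₁, hx₁T, hx₁, hpx₁⟩ : ∃ x ∈ T, x ∉ S ∧ p • x ∈ S := by
    have hex : ∃ j, p ^ j • x₀ ∈ S := ⟨n, by simp [h.pow_eq_zero]⟩
    have h0 : Nat.find hex ≠ 0 := fun h0 => hx₀ (by simpa [h0] using Nat.find_spec hex)
    obtain ⟨j, hj⟩ := Nat.exists_eq_succ_of_ne_zero h0
    refine ⟨p ^ j • x₀, T.smul_mem _ hx₀T, Nat.find_min hex (by omega), ?_⟩
    have := Nat.find_spec hex
    rwa [hj, pow_succ', mul_smul] at this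
  -- of maximal height in its coset
  have hexl : ∃ l, ∀ s ∈ S, x₁ + s ∉ heightGE p B (l + 1) := by
    refine ⟨n, fun s hs hmem => hx₁ ?_⟩
    have h0 := heightGE_antitone (p := p) (B := B) (Nat.le_succ n) hmem
    rw [h.heightGE_eq_bot, Submodule.mem_bot] at h0
    rw [eq_neg_of_add_eq_zero_left h0]
    exact S.neg_mem hs
  -- By minimality the bound fails one step earlier, so the coset reaches height `Nat.find hexl`;
  -- for the value 0 every element does.
  obtain ⟨s, hs, hxs⟩ : ∃ s ∈ S, x₁ + s ∈ heightGE p B (Nat.find hexl) := by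
    rcases hl : Nat.find hexl with _ | l
    · exact ⟨0, S.zero_mem, by simp [heightGE_zero]⟩
    · have := Nat.find_min hexl (m := l) (by omega)
      push Not at this
      exact this
  have hlmax := Nat.find_spec hexl
  set l := Nat.find hexl
  have hsT : s ∈ T := by
    obtain ⟨y, hy⟩ := (memS _).1 hs
    exact hT _ (h₂ hy)
  have hxT := T.add_mem hx₁T hsT
  obtain ⟨t, ht⟩ := (memS _).1 (show p • (x₁ + s) ∈ S by
    rw [smul_add]; exact S.add_mem hpx₁ (S.smul_mem p hs))
  obtain ⟨y, hyl, hyG, rfl⟩ := step Γ h₁ h₃ _ hxT t ht l hxs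
  refine hmax (Γ ⊔ Submodule.span R {(x₁ + s, y)}) ⟨h₁.trans le_sup_left,
    sup_le h₂ ((Submodule.span_singleton_le_iff_mem _ _).2 hyG),
    h₃.sup_span h ht hxs hyl fun z hz hmem =>
      hlmax (s + z.1) (S.add_mem hs ⟨z, hz, rfl⟩) (by rwa [← add_assoc])⟩ ?_
  refine lt_of_le_of_ne le_sup_left fun heq => hx₁ ?_
  have : x₁ + s ∈ S := (memS _).2 ⟨y, by
    rw [heq]; exact Submodule.mem_sup_right (Submodule.mem_span_singleton_self _)⟩
  simpa using S.sub_mem this hs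

/-- The element 0 has every height, in particular n, and so does y. Hence height increasing
relations are single-valued. -/
theorem HeightIncreasing.eq_zero (h : IsUniformizer σ p n) {Γ : Submodule R (B × D)}
    (hΓ : HeightIncreasing p Γ) {y : D} (hy : (0, y) ∈ Γ) : y = 0 := by
  have := hΓ _ hy n (Submodule.zero_mem _)
  rwa [h.heightGE_eq_bot, Submodule.mem_bot] at this

/-- A height increasing relation is contained in the graph of a linear map. -/
theorem HeightIncreasing.exists_linearMap [IsNoetherian R (B × D)] (h : IsUniformizer σ p n)
    {Γ₀ : Submodule R (B × D)} (hΓ₀ : HeightIncreasing p Γ₀) :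
    ∃ f : B →ₗ[R] D, ∀ z ∈ Γ₀, f z.1 = z.2 := by
  obtain ⟨Γ, hle, -, hΓ, htot⟩ := hΓ₀.exists_extension h (G := ⊤) (T := ⊤) le_top
    (fun _ _ => trivial) (by
      intro Γ _ hΓ x _ t ht l hl
      -- Since p • x has height at least l + 1, so has its image t; dividing t by p gives y of
      -- height at least l.
      obtain ⟨y, hy, hyt⟩ := mem_heightGE_succ.1
        (hΓ _ ht (l + 1) (mem_heightGE_succ.2 ⟨x, hl, rfl⟩))
      exact ⟨y, hy, trivial, hyt⟩)
  have hbij : Function.Bijective (LinearMap.fst R B D ∘ₗ Γ.subtype) := by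
    constructor
    · rw [injective_iff_map_eq_zero]
      rintro ⟨⟨x, y⟩, hz⟩ (rfl : x = 0)
      have := hΓ.eq_zero h hz
      subst this
      rfl
    · intro x
      obtain ⟨y, hy⟩ := htot x trivial
      exact ⟨⟨_, hy⟩, rfl⟩
  let e := LinearEquiv.ofBijective _ hbij
  refine ⟨LinearMap.snd R B D ∘ₗ Γ.subtype ∘ₗ e.symm.toLinearMap, fun z hz => ?_⟩
  have : e.symm z.1 = ⟨z, hle hz⟩ := by
    rw [LinearEquiv.symm_apply_eq]; rfl
  simp [this]

end Height

/-! ### Pairs, presentations of A⁺/A⁻, and lifting of morphisms. -/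

section Presentation

variable {Λ : Type u} [CommRing Λ] {k : Type w} [Field k] {σ : Λ →+* k} {p : Λ} {n : ℕ}

namespace IsUniformizer

theorem mem_Aminus (h : IsUniformizer σ p n) {X : SubmodulePair Λ} {x : X.B} :
    x ∈ X.Aminus ↔ ∃ a ∈ X.A, p • a = x := by
  rw [SubmodulePair.Aminus, h.jacobson_eq, Submodule.ideal_span_singleton_smul,
    Submodule.mem_smul_pointwise_iff_exists]

theorem mem_soc (h : IsUniformizer σ p n) {X : SubmodulePair Λ} {x : X.B} :
    x ∈ X.soc ↔ p • x = 0 := by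
  rw [SubmodulePair.soc, h.jacobson_eq, Submodule.mem_torsionBySet_iff]
  constructor
  · intro hx
    exact hx ⟨p, Ideal.mem_span_singleton_self p⟩
  · rintro hx ⟨a, ha⟩
    obtain ⟨b, rfl⟩ := Ideal.mem_span_singleton.1 ha
    change (p * b) • x = 0
    rw [mul_comm, mul_smul, hx, smul_zero]

theorem bounded_iff (h : IsUniformizer σ p n) {X : SubmodulePair Λ} {m : ℕ} :
    SubmodulePair.bounded Λ m X ↔ ∀ a ∈ X.A, p ^ m • a = 0 := by
  rw [SubmodulePair.bounded, h.jacobson_eq, Ideal.span_singleton_pow,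
    Submodule.ideal_span_singleton_smul, eq_bot_iff]
  constructor
  · intro hX a ha
    exact hX (Submodule.smul_mem_pointwise_smul a _ _ ha)
  · intro hX x hx
    obtain ⟨a, ha, rfl⟩ := (Submodule.mem_smul_pointwise_iff_exists _ _ _).1 hx
    exact hX a ha

/-- The bound p²A = 0 enters here: pA⁻ = p²A. -/
theorem Aminus_le_soc (h : IsUniformizer σ p n) (X : BoundedPair Λ 2) :
    X.obj.Aminus ≤ X.obj.soc := by
  intro x hx
  obtain ⟨a, ha, rfl⟩ := h.mem_Aminus.1 hx
  rw [h.mem_soc, smul_smul, ← sq]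
  exact h.bounded_iff.1 X.property a ha

theorem Aminus_le_A (h : IsUniformizer σ p n) (X : SubmodulePair Λ) : X.Aminus ≤ X.A := by
  intro x hx
  obtain ⟨a, ha, rfl⟩ := h.mem_Aminus.1 hx
  exact X.A.smul_mem p ha

/-- The socle is killed by p, so pA⁺ = pA. This makes A⁺/A⁻ a vector space over k. -/
theorem smul_mem_Aminus (h : IsUniformizer σ p n) {X : SubmodulePair Λ} {x : X.B}
    (hx : x ∈ X.Aplus) : p • x ∈ X.Aminus := by
  obtain ⟨a, ha, s, hs, rfl⟩ := Submodule.mem_sup.1 hx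
  rw [smul_add, h.mem_soc.1 hs, add_zero]
  exact h.mem_Aminus.2 ⟨a, ha, rfl⟩

end IsUniformizer

/-- An identification of the representation `V` with `A⁺ / A⁻`, filtered by the heights in `B`, and
its subspaces `soc B / A⁻` and `A / A⁻`. -/
structure PairPresentation (σ : Λ →+* k) (p : Λ) (X : BoundedPair Λ 2) (V : RepPrime k n) where
  toMap : X.obj.Aplus →ₛₗ[σ] V.obj.total
  surjective : Function.Surjective toMap
  map_eq_zero_iff : ∀ a, toMap a = 0 ↔ (a : X.obj.B) ∈ X.obj.Aminus
  mem_level_iff : ∀ l < n, ∀ v, v ∈ V.obj.level l ↔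
    ∃ a : X.obj.Aplus, (a : X.obj.B) ∈ heightGE p X.obj.B l ∧ toMap a = v
  mem_prime_iff : ∀ v, v ∈ V.obj.prime ↔
    ∃ a : X.obj.Aplus, (a : X.obj.B) ∈ X.obj.soc ∧ toMap a = v
  mem_dprime_iff : ∀ v, v ∈ V.obj.dprime ↔
    ∃ a : X.obj.Aplus, (a : X.obj.B) ∈ X.obj.A ∧ toMap a = v

theorem PosetRep.mem_sub_iff_level {V : PosetRep k (PosetP n)} (i : (Set.Ico 1 n)ᵒᵈ)
    (v : V.total) : v ∈ V.sub (Sum.inl i) ↔ v ∈ V.level (OrderDual.ofDual i : Set.Ico 1 n) := by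
  rw [PosetRep.level, dif_pos (OrderDual.ofDual i).2]
  rfl

/-- Linear maps respect all the subspaces if they respect the `V^l`, `V'` and `V''`. -/
theorem PosetRep.mem_homs_iff {V W : PosetRep k (PosetP n)} (f : V.total →ₗ[k] W.total) :
    f ∈ PosetRep.homs V W ↔ (∀ l < n, ∀ v ∈ V.level l, f v ∈ W.level l) ∧
      (∀ v ∈ V.prime, f v ∈ W.prime) ∧ ∀ v ∈ V.dprime, f v ∈ W.dprime := by
  constructor
  · refine fun hf => ⟨fun l _ v hv => ?_, fun v hv => hf _ v hv, fun v hv => hf _ v hv⟩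
    by_cases hl : l ∈ Set.Ico 1 n
    · rw [PosetRep.level, dif_pos hl] at hv ⊢
      exact hf _ v hv
    · rw [PosetRep.level, dif_neg hl]
      trivial
  · rintro ⟨h₁, h₂, h₃⟩ (i | i | i) v hv
    · rw [PosetRep.mem_sub_iff_level] at hv ⊢
      exact h₁ _ (OrderDual.ofDual i).2.2 v hv
    · exact h₂ v hv
    · exact h₃ v hv

namespace PairPresentation

variable {X Y : BoundedPair Λ 2} {V W : RepPrime k n}

/-- The map `A⁺ → C⁺` induced by a morphism `(B; A) → (D; C)`. -/
def mapAplus (f : X ⟶ Y) (a : X.obj.Aplus) : Y.obj.Aplus :=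
  ⟨SubmodulePair.toLin f.hom a, SubmodulePair.map_mem_Aplus f.hom a.2⟩

theorem mapAplus_add (f : X ⟶ Y) (a b : X.obj.Aplus) :
    mapAplus f (a + b) = mapAplus f a + mapAplus f b :=
  Subtype.ext (map_add (SubmodulePair.toLin f.hom) (a : X.obj.B) b)

theorem mapAplus_smul (f : X ⟶ Y) (r : Λ) (a : X.obj.Aplus) :
    mapAplus f (r • a) = r • mapAplus f a :=
  Subtype.ext (map_smul (SubmodulePair.toLin f.hom) r (a : X.obj.B))

theorem eq_iff (P : PairPresentation σ p X V) {a b : X.obj.Aplus} :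
    P.toMap a = P.toMap b ↔ (a : X.obj.B) - b ∈ X.obj.Aminus := by
  rw [← sub_eq_zero, ← map_sub, P.map_eq_zero_iff]
  rfl

/-- Every morphism of pairs induces a morphism of representations. -/
theorem exists_map (h : IsUniformizer σ p n) (P : PairPresentation σ p X V)
    (Q : PairPresentation σ p Y W) (f : X ⟶ Y) :
    ∃ φ : V ⟶ W, ∀ a, φ.hom.1 (P.toMap a) = Q.toMap (mapAplus f a) := by
  have hwd : ∀ a b, P.toMap a = P.toMap b →
      Q.toMap (mapAplus f a) = Q.toMap (mapAplus f b) := by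
    intro a b hab
    rw [P.eq_iff] at hab
    rw [Q.eq_iff]
    have := SubmodulePair.map_mem_Aminus f.hom hab
    rwa [map_sub] at this
  let g : V.obj.total → W.obj.total := fun v =>
    Q.toMap (mapAplus f (Function.surjInv P.surjective v))
  have hg : ∀ a, g (P.toMap a) = Q.toMap (mapAplus f a) := fun a =>
    hwd _ _ (Function.surjInv_eq P.surjective _)
  let φ : V.obj.total →ₗ[k] W.obj.total :=
    { toFun := g
      map_add' := by
        intro x y
        obtain ⟨a, rfl⟩ := P.surjective x
        obtain ⟨b, rfl⟩ := P.surjective y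
        rw [← map_add, hg, hg, hg, mapAplus_add, map_add]
      map_smul' := by
        intro c x
        obtain ⟨a, rfl⟩ := P.surjective x
        obtain ⟨r, rfl⟩ := h.surjective c
        rw [← LinearMap.map_smulₛₗ, hg, hg, mapAplus_smul, LinearMap.map_smulₛₗ]
        rfl }
  have hφ : φ ∈ PosetRep.homs V.obj W.obj := by
    rw [PosetRep.mem_homs_iff]
    refine ⟨fun l hl v hv => ?_, fun v hv => ?_, fun v hv => ?_⟩
    · obtain ⟨a, ha, rfl⟩ := (P.mem_level_iff l hl v).1 hv
      exact (Q.mem_level_iff l hl _).2 ⟨mapAplus f a, map_mem_heightGE _ ha, (hg a).symm⟩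
    · obtain ⟨a, ha, rfl⟩ := (P.mem_prime_iff v).1 hv
      refine (Q.mem_prime_iff _).2 ⟨mapAplus f a, ?_, (hg a).symm⟩
      rw [h.mem_soc] at ha ⊢
      exact (map_smul (SubmodulePair.toLin f.hom) p (a : X.obj.B)).symm.trans (by rw [ha, map_zero])
    · obtain ⟨a, ha, rfl⟩ := (P.mem_dprime_iff v).1 hv
      exact (Q.mem_dprime_iff _).2 ⟨mapAplus f a, f.hom.2 _ ha, (hg a).symm⟩
  exact ⟨⟨⟨φ, hφ⟩⟩, hg⟩

theorem hom_ext (P : PairPresentation σ p X V) {φ ψ : V ⟶ W}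
    (hφ : ∀ a, φ.hom.1 (P.toMap a) = ψ.hom.1 (P.toMap a)) : φ = ψ := by
  apply ObjectProperty.hom_ext
  apply Subtype.ext
  apply LinearMap.ext
  intro v
  obtain ⟨a, rfl⟩ := P.surjective v
  exact hφ a

/-- Every morphism of representations is induced by a morphism of pairs. -/
theorem exists_lift [IsNoetherianRing Λ] (h : IsUniformizer σ p n) (P : PairPresentation σ p X V)
    (Q : PairPresentation σ p Y W) (φ : V ⟶ W) :
    ∃ f : X ⟶ Y, ∀ a, φ.hom.1 (P.toMap a) = Q.toMap (mapAplus f a) := by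
  obtain ⟨hl, hp, hd⟩ := (PosetRep.mem_homs_iff φ.hom.1).1 φ.hom.2
  -- A linear map whose restriction to A⁺ has its graph in G induces φ.
  let G : Submodule Λ (X.obj.B × Y.obj.B) :=
    { carrier := {z | ∃ (a : X.obj.Aplus) (c : Y.obj.Aplus),
        φ.hom.1 (P.toMap a) = Q.toMap c ∧ z = ((a : X.obj.B), (c : Y.obj.B))}
      zero_mem' := ⟨0, 0, by simp, rfl⟩
      add_mem' := by
        rintro _ _ ⟨a, c, hac, rfl⟩ ⟨a', c', hac', rfl⟩
        exact ⟨a + a', c + c', by simp [hac, hac'], rfl⟩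
      smul_mem' := by
        rintro r _ ⟨a, c, hac, rfl⟩
        exact ⟨r • a, r • c, by simp [LinearMap.map_smulₛₗ, hac], rfl⟩ }
  -- every element of `A⁺` of height at least `l` is related to one of `C⁺` of height at least `l`
  have lift_level : ∀ (a : X.obj.Aplus) (l : ℕ), (a : X.obj.B) ∈ heightGE p X.obj.B l →
      ∃ c : Y.obj.Aplus, (c : Y.obj.B) ∈ heightGE p Y.obj.B l ∧
        φ.hom.1 (P.toMap a) = Q.toMap c := by
    intro a l ha
    by_cases hln : l < n
    · obtain ⟨c, hc, hca⟩ := (Q.mem_level_iff l hln _).1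
        (hl l hln _ ((P.mem_level_iff l hln _).2 ⟨a, ha, rfl⟩))
      exact ⟨c, hc, hca.symm⟩
    · have h0 := heightGE_antitone (not_lt.1 hln) ha
      rw [h.heightGE_eq_bot, Submodule.mem_bot] at h0
      have : a = 0 := Subtype.ext h0
      subst this
      exact ⟨0, Submodule.zero_mem _, by simp⟩
  -- related elements of `A⁺` and `C⁺` stay in the socle
  have soc_of_related : ∀ (a : X.obj.Aplus) (c : Y.obj.Aplus), φ.hom.1 (P.toMap a) = Q.toMap c →
      (a : X.obj.B) ∈ X.obj.soc → p • (c : Y.obj.B) = 0 := by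
    intro a c hac ha
    obtain ⟨c', hc', hcc'⟩ := (Q.mem_prime_iff _).1 (hp _ ((P.mem_prime_iff _).2 ⟨a, ha, rfl⟩))
    rw [hac, Q.eq_iff] at hcc'
    rw [← h.mem_soc]
    have := Submodule.sub_mem _ hc' (h.Aminus_le_soc Y hcc')
    rwa [sub_sub_cancel] at this
  -- If p • a = p • z with z of height l, then a - z is in the socle, so z lies in A⁺ and has a
  -- partner c' of height l. As c - c' is related to a - z, it is in the socle too, and p • c = p •
  -- c' has height l + 1.
  have hΓ₀ : HeightIncreasing p (G.map (LinearMap.lsmul Λ _ p)) := by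
    rintro _ ⟨_, ⟨a, c, hac, rfl⟩, rfl⟩ l hlB
    change p • (a : X.obj.B) ∈ _ at hlB
    change p • (c : Y.obj.B) ∈ _
    rcases l with _ | l
    · simp [heightGE_zero]
    obtain ⟨z, hz, hza⟩ := mem_heightGE_succ.1 hlB
    have hzs : (a : X.obj.B) - z ∈ X.obj.soc := by
      rw [h.mem_soc, smul_sub, hza, sub_self]
    have hzA : z ∈ X.obj.Aplus := by
      have := Submodule.sub_mem _ a.2 (Submodule.mem_sup_right (S := X.obj.A) hzs)
      rwa [sub_sub_cancel] at this
    obtain ⟨c', hc', hzc'⟩ := lift_level ⟨z, hzA⟩ l hz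
    have := soc_of_related (a - ⟨z, hzA⟩) (c - c') (by rw [map_sub, map_sub, map_sub, hac, hzc'])
      hzs
    refine mem_heightGE_succ.2 ⟨c', hc', ?_⟩
    change p • ((c : Y.obj.B) - c') = 0 at this
    rw [smul_sub, sub_eq_zero] at this
    exact this.symm
  obtain ⟨Γ, -, hΓG, hΓ, htot⟩ := hΓ₀.exists_extension h (G := G) (T := X.obj.Aplus)
    (by rintro _ ⟨z, hz, rfl⟩; exact G.smul_mem p hz)
    (by rintro _ ⟨a, c, -, rfl⟩; exact a.2)
    (by
      intro Γ hle hΓ x hx t ht l hxl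
      -- Any partner c of x with height l works: (p • x, p • c) lies in pG ⊆ Γ, and Γ is
      -- single-valued, so p • c = t.
      obtain ⟨c, hc, hxc⟩ := lift_level ⟨x, hx⟩ l hxl
      refine ⟨c, hc, ⟨⟨x, hx⟩, c, hxc, rfl⟩, ?_⟩
      have hmem : (p • x, p • (c : Y.obj.B)) ∈ Γ := hle ⟨(x, c), ⟨⟨x, hx⟩, c, hxc, rfl⟩, rfl⟩
      have := hΓ.eq_zero h (y := p • (c : Y.obj.B) - t) (by simpa using Γ.sub_mem hmem ht)
      exact sub_eq_zero.1 this)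
  obtain ⟨f, hf⟩ := hΓ.exists_linearMap h
  have hrel : ∀ a : X.obj.Aplus, ∃ c : Y.obj.Aplus, φ.hom.1 (P.toMap a) = Q.toMap c ∧
      f a = c := by
    intro a
    obtain ⟨y, hy⟩ := htot a a.2
    obtain ⟨a', c, hac, heq⟩ := hΓG hy
    obtain ⟨h₁, h₂⟩ := Prod.mk.inj heq
    obtain rfl : a = a' := Subtype.ext h₁
    exact ⟨c, hac, (hf _ hy).trans h₂⟩
  have hfA : f ∈ SubmodulePair.homs X.obj Y.obj := by
    intro x hx
    obtain ⟨c, hac, hfc⟩ := hrel ⟨x, Submodule.mem_sup_left hx⟩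
    obtain ⟨c', hc', hcc'⟩ := (Q.mem_dprime_iff _).1
      (hd _ ((P.mem_dprime_iff _).2 ⟨⟨x, Submodule.mem_sup_left hx⟩, hx, rfl⟩))
    rw [hac, Q.eq_iff] at hcc'
    change f x = c at hfc
    -- Passing to another representative changes c by an element of C⁻ ⊆ C only.
    have := Submodule.sub_mem _ hc' (h.Aminus_le_A _ hcc')
    rwa [sub_sub_cancel, ← hfc] at this
  refine ⟨⟨⟨f, hfA⟩⟩, fun a => ?_⟩
  obtain ⟨c, hac, hfc⟩ := hrel a
  rw [hac]
  exact congrArg Q.toMap (Subtype.ext hfc.symm)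

end PairPresentation

end Presentation

/-! ### Bases adapted to a filtration. -/

section AdaptedBasis

variable {K : Type u} [Field K] {V : Type v} [AddCommGroup V] [Module K V]

/-- A basis such that every step of a filtration `F` is spanned by the basis vectors of sufficiently
large level. -/
structure Module.Basis.IsAdapted {ι : Type*} (b : Module.Basis ι K V) (F : ℕ → Submodule K V)
    (lev : ι → ℕ) : Prop where
  mem : ∀ i, b i ∈ F (lev i)
  le_span : ∀ l, F l ≤ Submodule.span K (b '' {i | l ≤ lev i})

/-- Each basis vector of the quotient is lifted inside its own step of F. A vector of F l then
differs from a combination of lifts in F l by an element of W ∩ F l, which b₁ covers. -/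
theorem Module.Basis.IsAdapted.exists_sum {ι₁ ι₂ : Type} {F : ℕ → Submodule K V}
    (hF : Antitone F) (hF0 : F 0 = ⊤) {W : Submodule K V} {b₁ : Module.Basis ι₁ K W}
    {b₂ : Module.Basis ι₂ K (V ⧸ W)} {lev₁ : ι₁ → ℕ} {lev₂ : ι₂ → ℕ}
    (h₁ : b₁.IsAdapted (fun l => (F l).comap W.subtype) lev₁)
    (h₂ : b₂.IsAdapted (fun l => (F l).map W.mkQ) lev₂) :
    ∃ b : Module.Basis (ι₁ ⊕ ι₂) K V, b.IsAdapted F (Sum.elim lev₁ lev₂) ∧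
      Submodule.span K (b '' Set.range Sum.inl) = W := by
  choose e he heq using h₂.mem
  let g : ι₁ ⊕ ι₂ → V := Sum.elim (fun i => (b₁ i : V)) e
  have hspan : ∀ l, F l ≤ Submodule.span K (g '' {i | l ≤ Sum.elim lev₁ lev₂ i}) := by
    intro l v hv
    have h₂v := h₂.le_span l ⟨v, hv, rfl⟩
    have himg : (b₂ '' {j | l ≤ lev₂ j}) = W.mkQ '' (e '' {j | l ≤ lev₂ j}) := by
      rw [Set.image_image]
      exact Set.image_congr fun j _ => (heq j).symm
    rw [himg, Submodule.span_image] at h₂v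
    obtain ⟨x, hx, hxv⟩ := h₂v
    have hxF : x ∈ F l := by
      refine Submodule.span_le.2 ?_ hx
      rintro _ ⟨j, hj, rfl⟩
      exact hF hj (he j)
    have hxW : v - x ∈ W := by
      rw [← Submodule.Quotient.mk_eq_zero, Submodule.Quotient.mk_sub, sub_eq_zero]
      exact hxv.symm
    have h₁v := h₁.le_span l (show (⟨v - x, hxW⟩ : W) ∈ _ from Submodule.sub_mem _ hv hxF)
    have h₁v' := Submodule.mem_map_of_mem (f := W.subtype) h₁v
    rw [← Submodule.span_image] at h₁v'
    rw [← sub_add_cancel v x]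
    refine Submodule.add_mem _ (Submodule.span_mono ?_ h₁v') (Submodule.span_mono ?_ hx)
    · rintro _ ⟨_, ⟨i, hi, rfl⟩, rfl⟩
      exact ⟨Sum.inl i, hi, rfl⟩
    · rintro _ ⟨j, hj, rfl⟩
      exact ⟨Sum.inr j, hj, rfl⟩
  have hli : LinearIndependent K g := by
    refine LinearIndependent.sumElim_of_quotient (f := b₁) b₁.linearIndependent e ?_
    have : (Submodule.Quotient.mk ∘ e : ι₂ → V ⧸ W) = b₂ := funext heq
    rw [this]
    exact b₂.linearIndependent
  have htop : ⊤ ≤ Submodule.span K (Set.range g) := by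
    rw [← hF0]
    exact (hspan 0).trans (Submodule.span_mono (Set.image_subset_range _ _))
  refine ⟨Module.Basis.mk hli htop, ⟨?_, ?_⟩, ?_⟩
  · rintro (i | j)
    · simpa [g] using h₁.mem i
    · simpa [g] using he j
  · simpa using hspan
  · rw [Module.Basis.coe_mk, ← Set.range_comp]
    have : g ∘ Sum.inl = W.subtype ∘ b₁ := rfl
    rw [this, Set.range_comp, Submodule.span_image, b₁.span_eq, Submodule.map_top,
      Submodule.range_subtype]

/-- Induction on the length: on the last step F n, whose next step vanishes, every basis is adapted
with constant level n, and the quotient by F n has a shorter filtration. -/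
theorem exists_isAdapted_basis (n : ℕ) : ∀ {V : Type v} [AddCommGroup V] [Module K V]
    [Module.Finite K V] {F : ℕ → Submodule K V}, Antitone F → F 0 = ⊤ → F n = ⊥ →
    ∃ (ι : Type) (b : Module.Basis ι K V) (lev : ι → ℕ), b.IsAdapted F lev := by
  induction n with
  | zero =>
    intro V _ _ _ F hF h0 hn
    have : Subsingleton V := by
      rw [← Submodule.subsingleton_iff K, ← not_nontrivial_iff_subsingleton]
      intro hnt
      exact bot_ne_top (hn.symm.trans h0)
    exact ⟨Empty, Module.Basis.empty V, Empty.elim, fun i => i.elim, fun l v _ => by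
      rw [Subsingleton.elim v 0]; exact Submodule.zero_mem _⟩
  | succ n ih =>
    intro V _ _ _ F hF h0 hn
    obtain ⟨ι, b₂, lev, h₂⟩ := ih (V := V ⧸ F n) (F := fun l => (F l).map (F n).mkQ)
      (fun l m hlm => Submodule.map_mono (hF hlm))
      (by simp [h0]) (by simp)
    have h₁ : (Module.finBasis K (F n)).IsAdapted (fun l => (F l).comap (F n).subtype)
        (fun _ => n) := by
      refine ⟨fun i => ((Module.finBasis K (F n)) i).2, fun l v hv => ?_⟩
      by_cases hl : l ≤ n
      · have : {i : Fin (Module.finrank K (F n)) | l ≤ n} = Set.univ :=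
          Set.eq_univ_of_forall fun _ => hl
        rw [this, Set.image_univ, Module.Basis.span_eq]
        trivial
      · have hv0 : (v : V) ∈ F (n + 1) := hF (by omega) hv
        rw [hn, Submodule.mem_bot] at hv0
        rw [show v = 0 from Subtype.ext hv0]
        exact Submodule.zero_mem _
    obtain ⟨b, hb, -⟩ := h₁.exists_sum hF h0 h₂
    exact ⟨_, b, _, hb⟩

/-- A basis adapted to a filtration and a further subspace. -/
theorem exists_isAdapted_basis_subspace [Module.Finite K V] (n : ℕ) {F : ℕ → Submodule K V}
    (hF : Antitone F) (h0 : F 0 = ⊤) (hn : F n = ⊥) (W : Submodule K V) :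
    ∃ (ι : Type) (b : Module.Basis ι K V) (lev : ι → ℕ) (s : Set ι), b.IsAdapted F lev ∧
      Submodule.span K (b '' s) = W := by
  obtain ⟨ι₁, b₁, lev₁, h₁⟩ := exists_isAdapted_basis (K := K) (V := W) n
    (F := fun l => (F l).comap W.subtype) (fun l m hlm => Submodule.comap_mono (hF hlm))
    (by simp [h0]) (by simp [hn])
  obtain ⟨ι₂, b₂, lev₂, h₂⟩ := exists_isAdapted_basis (K := K) (V := V ⧸ W) n
    (F := fun l => (F l).map W.mkQ) (fun l m hlm => Submodule.map_mono (hF hlm))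
    (by simp [h0]) (by simp [hn])
  obtain ⟨b, hb, hW⟩ := h₁.exists_sum hF h0 h₂
  exact ⟨_, b, _, _, hb, hW⟩

end AdaptedBasis

/-! ### From pairs to representations. -/

section ExistsPresentation

variable {Λ : Type u} [CommRing Λ] {k : Type w} [Field k] {σ : Λ →+* k} {p : Λ} {n : ℕ}

/-- A finitely generated module modulo a submodule that contains `p • M` is a finite dimensional
vector space over `k`. -/
theorem IsUniformizer.exists_coordinates (h : IsUniformizer σ p n) {M : Type v} [AddCommGroup M]
    [Module Λ M] [Module.Finite Λ M] (N : Submodule Λ M) (hN : ∀ m : M, p • m ∈ N) :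
    ∃ (d : ℕ) (c : M →ₛₗ[σ] (Fin d → k)), Function.Surjective c ∧ ∀ a, c a = 0 ↔ a ∈ N := by
  -- Scalars act through a set-theoretic section of σ; two lifts differ by a multiple of p, which
  -- kills M/N.
  let _ : SMul k (M ⧸ N) := ⟨fun r q => Function.surjInv h.surjective r • q⟩
  have hsmul : ∀ (r : Λ) (q : M ⧸ N), σ r • q = r • q := by
    intro r q
    obtain ⟨m, rfl⟩ := N.mkQ_surjective q
    have h0 : σ (Function.surjInv h.surjective (σ r) - r) = 0 := by
      rw [map_sub, Function.surjInv_eq h.surjective, sub_self]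
    obtain ⟨t, ht⟩ := (h.map_eq_zero_iff _).1 h0
    change Function.surjInv h.surjective (σ r) • N.mkQ m = r • N.mkQ m
    rw [← sub_eq_zero, ← sub_smul, ht, mul_smul, ← map_smul, ← map_smul]
    exact (Submodule.Quotient.mk_eq_zero N).2 (hN _)
  let _ : Module k (M ⧸ N) := Function.Surjective.moduleLeft σ h.surjective hsmul
  have : RingHomSurjective σ := ⟨h.surjective⟩
  let π : M →ₛₗ[σ] (M ⧸ N) :=
    { toFun := N.mkQ
      map_add' := map_add _
      map_smul' := fun r m => by rw [map_smul, hsmul] }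
  have hπ : Function.Surjective π := N.mkQ_surjective
  have : Module.Finite k (M ⧸ N) := Module.Finite.of_surjective π hπ
  let e := (Module.finBasis k (M ⧸ N)).equivFun
  refine ⟨_, e.toLinearMap.comp π, e.surjective.comp hπ, fun a => ?_⟩
  change e (π a) = 0 ↔ _
  rw [LinearEquiv.map_eq_zero_iff]
  exact Submodule.Quotient.mk_eq_zero N

/-- Every pair determines a representation. -/
theorem PairPresentation.exists_rep [IsNoetherianRing Λ] (h : IsUniformizer σ p n)
    (X : BoundedPair Λ 2) : ∃ V : RepPrime k n, Nonempty (PairPresentation σ p X V) := by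
  obtain ⟨d, c, hc, hker⟩ := h.exists_coordinates (M := X.obj.Aplus)
    (X.obj.Aminus.comap X.obj.Aplus.subtype) (fun m => h.smul_mem_Aminus m.2)
  have : RingHomSurjective σ := ⟨h.surjective⟩
  let im : Submodule Λ X.obj.B → Submodule k (Fin d → k) := fun S =>
    (S.comap X.obj.Aplus.subtype).map c
  have im_mono : Monotone im := fun S T hST => Submodule.map_mono (Submodule.comap_mono hST)
  have mem_im : ∀ S v, v ∈ im S ↔ ∃ a : X.obj.Aplus, (a : X.obj.B) ∈ S ∧ c a = v :=
    fun S v => Iff.rfl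
  let V : PosetRep k (PosetP n) :=
    { total := Fin d → k
      sub :=
        { toFun := Sum.elim (fun i => im (heightGE p X.obj.B (OrderDual.ofDual i : Set.Ico 1 n)))
            (Sum.elim (fun _ => im X.obj.soc) (fun _ => im X.obj.A))
          monotone' := by
            rintro (i | i | i) (j | j | j) hij
            · exact im_mono (heightGE_antitone (show (OrderDual.ofDual j : Set.Ico 1 n) ≤
                OrderDual.ofDual i from (Sum.inl_le_inl_iff.1 hij : i ≤ j)))
            all_goals first
              | exact le_rfl
              | simp at hij } }
  have hlev : ∀ l < n, V.level l = im (heightGE p X.obj.B l) := by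
    intro l hl
    by_cases h1 : 1 ≤ l
    · rw [PosetRep.level, dif_pos ⟨h1, hl⟩]
      rfl
    · obtain rfl : l = 0 := by omega
      rw [PosetRep.level, dif_neg (by simp), heightGE_zero]
      refine (eq_top_iff.2 fun v _ => ?_).symm
      obtain ⟨a, rfl⟩ := hc v
      exact ⟨a, trivial, rfl⟩
  have hV : PosetRep.restricted k n V := by
    constructor
    -- V^{n-1} ⊆ V' because p · p^(n-1) = 0; V' + V'' = V⁰ because A⁺ = A + soc B.
    · rw [hlev _ (Nat.sub_lt h.pos one_pos)]
      refine im_mono ?_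
      rintro _ ⟨z, rfl⟩
      rw [h.mem_soc, LinearMap.lsmul_apply, smul_smul, ← pow_succ',
        show n - 1 + 1 = n from Nat.sub_add_cancel h.pos, h.pow_eq_zero, zero_smul]
    · refine eq_top_iff.2 fun v _ => ?_
      obtain ⟨⟨x, hx⟩, rfl⟩ := hc v
      obtain ⟨a, ha, s, hs, rfl⟩ := Submodule.mem_sup.1 hx
      have : (⟨a + s, hx⟩ : X.obj.Aplus) = ⟨s, Submodule.mem_sup_right hs⟩ +
        ⟨a, Submodule.mem_sup_left ha⟩ := Subtype.ext (add_comm a s)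
      rw [this, map_add]
      exact Submodule.add_mem_sup ⟨_, hs, rfl⟩ ⟨_, ha, rfl⟩
  exact ⟨⟨V, hV⟩, ⟨c, hc, hker, fun l hl v => by rw [← mem_im, ← hlev l hl],
    fun v => Iff.rfl, fun v => Iff.rfl⟩⟩

end ExistsPresentation

/-! ### From representations to pairs. -/

section Density

variable {Λ : Type u} [CommRing Λ] {k : Type w} [Field k] {σ : Λ →+* k} {p : Λ} {n : ℕ}

/-- A semilinear map on `L` that vanishes on the kernel of `γ : L → M` factors through the range of
`γ`. -/
theorem exists_semilinear_factor {L : Type*} {M : Type*} {V : Type*} [AddCommGroup L] [Module Λ L]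
    [AddCommGroup M] [Module Λ M] [AddCommGroup V] [Module k V] (γ : L →ₗ[Λ] M)
    (δ : L →ₛₗ[σ] V) (S : Submodule Λ M) (hS : LinearMap.range γ = S)
    (hker : ∀ a, γ a = 0 → δ a = 0) :
    ∃ c : S →ₛₗ[σ] V, ∀ (a : L) (ha : γ a ∈ S), c ⟨γ a, ha⟩ = δ a := by
  subst hS
  let γ' := γ.rangeRestrict
  refine ⟨((LinearMap.ker γ').liftQ δ fun a ha => ?_).comp
    (γ'.quotKerEquivOfSurjective γ.surjective_rangeRestrict).symm.toLinearMap, fun a ha => ?_⟩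
  · exact hker a (congrArg Subtype.val (LinearMap.mem_ker.1 ha))
  · have : (γ'.quotKerEquivOfSurjective γ.surjective_rangeRestrict).symm ⟨γ a, ha⟩ =
        (LinearMap.ker γ').mkQ a := by
      rw [LinearEquiv.symm_apply_eq]
      rfl
    simp only [LinearMap.comp_apply, LinearEquiv.coe_coe, this]
    rfl

/-- The filtration `V⁰ ⊇ V¹ ⊇ ⋯ ⊇ V^{n-1} ⊇ 0`. -/
def PosetRep.filtration (V : PosetRep k (PosetP n)) (l : ℕ) : Submodule k V.total :=
  if l < n then V.level l else ⊥

theorem PosetRep.filtration_antitone (V : PosetRep k (PosetP n)) : Antitone V.filtration := by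
  intro l m hlm
  rw [filtration, filtration]
  split_ifs with hm hl
  · rw [level, level]
    split_ifs with hm' hl' hl'
    · exact V.sub.monotone (Sum.inl_le_inl_iff.2 hlm)
    · exact le_top
    · exact absurd ⟨by have := hl'.1; omega, hm⟩ hm'
    · exact le_rfl
  · omega
  · exact bot_le
  · exact le_rfl

/-- Coordinates that are adapted to the subspaces `V^l` and `V'`. -/
theorem IsUniformizer.exists_adapted_coordinates (h : IsUniformizer σ p n) (V : RepPrime k n) :
    ∃ (ι : Type) (_ : Fintype ι) (e : (ι → k) ≃ₗ[k] V.obj.total) (lev : ι → ℕ) (s : Set ι),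
      (∀ i, lev i < n) ∧ (∀ i ∉ s, lev i + 1 < n) ∧
      (∀ l < n, ∀ x, e x ∈ V.obj.level l ↔ ∀ i, l ≤ lev i ∨ x i = 0) ∧
      ∀ x, e x ∈ V.obj.prime ↔ ∀ i ∉ s, x i = 0 := by
  classical
  have hn := h.pos
  obtain ⟨ι, b, lev, s, hb, hs⟩ := exists_isAdapted_basis_subspace n V.obj.filtration_antitone
    (by rw [PosetRep.filtration, if_pos hn, PosetRep.level, dif_neg (by simp)])
    (by rw [PosetRep.filtration, if_neg (lt_irrefl n)]) V.obj.prime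
  have : Fintype ι := Module.Basis.fintypeIndexOfRankLtAleph0 b (Module.rank_lt_aleph0 k _)
  have hspan : ∀ (S : Set ι) (x : ι → k), b.equivFun.symm x ∈ Submodule.span k (b '' S) ↔
      ∀ i, i ∈ S ∨ x i = 0 := by
    intro S x
    rw [Module.Basis.mem_span_image]
    have hrepr : ∀ i, b.repr (b.equivFun.symm x) i = x i := fun i =>
      congrFun (b.equivFun.apply_symm_apply x) i
    constructor
    · intro hx i
      by_cases h0 : x i = 0
      · exact Or.inr h0
      · exact Or.inl (hx (Finset.mem_coe.2 (Finsupp.mem_support_iff.2 (by rwa [hrepr]))))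
    · intro hx i hi
      have hi' : x i ≠ 0 := by
        rw [← hrepr]
        exact Finsupp.mem_support_iff.1 (Finset.mem_coe.1 hi)
      exact (hx i).resolve_right hi'
  have hlev : ∀ i, lev i < n := by
    intro i
    by_contra hi
    have := hb.mem i
    rw [PosetRep.filtration, if_neg hi, Submodule.mem_bot] at this
    exact b.ne_zero i this
  refine ⟨ι, this, b.equivFun.symm, lev, s, hlev, ?_, ?_, ?_⟩
  · intro i hi
    -- A basis vector of level n - 1 lies in V^{n-1} ⊆ V', the span of the vectors indexed by s, so
    -- its index is in s.
    by_contra hcon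
    have hlast : lev i = n - 1 := by have := hlev i; omega
    have := hb.mem i
    rw [PosetRep.filtration, if_pos (hlev i), hlast] at this
    have := V.property.1 this
    rw [← hs] at this
    have hx := (hspan s (Pi.single i 1)).1 (by simpa using this) i
    simp [hi] at hx
  · intro l hl x
    have : V.obj.level l = Submodule.span k (b '' {i | l ≤ lev i}) := by
      have hF : V.obj.filtration l = V.obj.level l := by rw [PosetRep.filtration, if_pos hl]
      rw [← hF]
      refine le_antisymm (hb.le_span l) (Submodule.span_le.2 ?_)
      rintro _ ⟨i, hi, rfl⟩
      exact V.obj.filtration_antitone hi (hb.mem i)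
    rw [this, hspan]
    rfl
  · intro x
    rw [← hs, hspan]
    exact forall_congr' fun i => or_iff_not_imp_left

/-- Every representation comes from a pair. -/
theorem PairPresentation.exists_pair [IsNoetherianRing Λ] (h : IsUniformizer σ p n)
    (V : RepPrime k n) : ∃ X : BoundedPair Λ 2, Nonempty (PairPresentation σ p X V) := by
  classical
  have hn := h.pos
  obtain ⟨ι, _, e, lev, s, hlev, hlev', hlevel, hprime⟩ := h.exists_adapted_coordinates V
  -- The ideal (p^(t i - lev i)) has length lev i + 1 for i ∈ s and lev i + 2 otherwise. In it p^(t
  -- i) is p^(lev i) times the generator, and it is killed by p exactly when i ∈ s.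
  let t : ι → ℕ := fun i => if i ∈ s then n - 1 else n - 2
  have ht_lt : ∀ i, t i + 1 ≤ n := fun i => by dsimp only [t]; split_ifs <;> omega
  have ht_mem : ∀ i ∈ s, t i + 1 = n := fun i hi => by simp only [t, if_pos hi]; omega
  have ht_not_mem : ∀ i ∉ s, t i + 2 = n := fun i hi => by
    have := hlev' i hi
    simp only [t, if_neg hi]; omega
  have hlev_le : ∀ i, lev i ≤ t i := fun i => by
    by_cases hi : i ∈ s
    · have := hlev i; have := ht_mem i hi; omega
    · have := hlev' i hi; have := ht_not_mem i hi; omega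
  let B : Submodule Λ (ι → Λ) :=
    Submodule.pi Set.univ fun i => Ideal.span {p ^ (t i - lev i)}
  have memB : ∀ x, x ∈ B ↔ ∀ i, p ^ (t i - lev i) ∣ x i := fun x => by
    simp [B, Submodule.mem_pi, Ideal.mem_span_singleton]
  let γ : (ι → Λ) →ₗ[Λ] B := LinearMap.codRestrict B
    (LinearMap.pi fun i => p ^ t i • LinearMap.proj i) fun a => (memB _).2 fun i =>
      (pow_dvd_pow p (Nat.sub_le _ _)).mul_right _
  have hγ : ∀ a i, (γ a : ι → Λ) i = p ^ t i * a i := fun a i => rfl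
  let δ : (ι → Λ) →ₛₗ[σ] V.obj.total :=
    { toFun := fun a => e fun i => σ (a i)
      map_add' := fun a a' => by
        rw [← map_add]; congr 1; ext i; simp
      map_smul' := fun r a => by
        rw [← map_smul]; congr 1; ext i; simp }
  have hδ : ∀ a, δ a = e fun i => σ (a i) := fun a => rfl
  have hδ_surj : Function.Surjective δ := fun v => by
    choose a ha using fun i => h.surjective (e.symm v i)
    exact ⟨a, by rw [hδ]; simp [ha]⟩
  have hδ_zero : ∀ a, δ a = 0 ↔ ∀ i, p ∣ a i := fun a => by
    rw [hδ, LinearEquiv.map_eq_zero_iff, funext_iff]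
    exact forall_congr' fun i => h.map_eq_zero_iff _
  have hδ_prime : ∀ a, δ a ∈ V.obj.prime ↔ ∀ i ∉ s, p ∣ a i := fun a => by
    simp only [hδ, hprime, h.map_eq_zero_iff]
  have hγ_dvd : ∀ a, γ a = 0 → ∀ i, p ∣ a i := fun a ha i => by
    have := h.pow_dvd_of_pow_mul_eq_zero (ht_lt i) (a := a i) (by rw [← hγ, ha]; rfl)
    simpa using this
  let A : Submodule Λ B := (V.obj.dprime.comap δ).map γ
  let X₀ : SubmodulePair Λ := { B := B, A := A }
  have hX₀ : SubmodulePair.bounded Λ 2 X₀ := by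
    rw [h.bounded_iff]
    rintro _ ⟨a, -, rfl⟩
    refine Subtype.ext (funext fun i => ?_)
    change p ^ 2 * (p ^ t i * a i) = 0
    rw [← mul_assoc, ← pow_add, pow_eq_zero_of_le _ h.pow_eq_zero, zero_mul]
    by_cases hi : i ∈ s
    · have := ht_mem i hi; omega
    · have := ht_not_mem i hi; omega
  have hsoc : ∀ x : B, p • x = 0 ↔ ∃ a, δ a ∈ V.obj.prime ∧ γ a = x := by
    intro x
    constructor
    · intro hx
      have hdvd : ∀ i, p ^ (n - 1) ∣ (x : ι → Λ) i := fun i =>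
        h.pow_dvd_of_pow_mul_eq_zero (i := 1) (by omega) (by
          rw [pow_one]; exact congrFun (congrArg Subtype.val hx) i)
      -- Outside s the exponent t i is n - 2, so a factor p remains and the coordinate vanishes in
      -- k.
      choose y hy using hdvd
      refine ⟨fun i => if i ∈ s then y i else p * y i, (hδ_prime _).2 fun i hi => ?_,
        Subtype.ext (funext fun i => ?_)⟩
      · simp [hi]
      · rw [hγ, hy]
        by_cases hi : i ∈ s
        · rw [if_pos hi, show t i = n - 1 by have := ht_mem i hi; omega]
        · rw [if_neg hi, ← mul_assoc, ← pow_succ,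
            show t i + 1 = n - 1 by have := ht_not_mem i hi; omega]
    · rintro ⟨a, ha, rfl⟩
      refine Subtype.ext (funext fun i => ?_)
      change p * (p ^ t i * a i) = 0
      by_cases hi : i ∈ s
      · rw [← mul_assoc, ← pow_succ', ht_mem i hi, h.pow_eq_zero, zero_mul]
      · obtain ⟨b, hb⟩ := (hδ_prime a).1 ha i hi
        rw [hb, show p * (p ^ t i * (p * b)) = p ^ (t i + 2) * b by ring, ht_not_mem i hi,
          h.pow_eq_zero, zero_mul]
  -- since `V' + V'' = V⁰`, every element decomposes into a socle part and a part in `A`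
  have hsplit : ∀ a, ∃ a₁ a₂, a = a₁ + a₂ ∧ δ a₁ ∈ V.obj.prime ∧ δ a₂ ∈ V.obj.dprime := by
    intro a
    have htop : δ a ∈ V.obj.prime ⊔ V.obj.dprime := by rw [V.property.2]; trivial
    obtain ⟨v₁, hv₁, v₂, hv₂, hv⟩ := Submodule.mem_sup.1 htop
    obtain ⟨a₁, rfl⟩ := hδ_surj v₁
    refine ⟨a₁, a - a₁, by simp, hv₁, ?_⟩
    rwa [map_sub, ← hv, add_sub_cancel_left]
  have hplus : LinearMap.range γ = X₀.Aplus := by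
    refine le_antisymm ?_ (sup_le ?_ ?_)
    · rintro _ ⟨a, rfl⟩
      obtain ⟨a₁, a₂, rfl, h₁, h₂⟩ := hsplit a
      rw [map_add]
      exact Submodule.add_mem _
        (Submodule.mem_sup_right (h.mem_soc.2 ((hsoc _).2 ⟨a₁, h₁, rfl⟩)))
        (Submodule.mem_sup_left ⟨a₂, h₂, rfl⟩)
    · rintro _ ⟨a, -, rfl⟩
      exact ⟨a, rfl⟩
    · intro x hx
      obtain ⟨a, -, rfl⟩ := (hsoc x).1 (h.mem_soc.1 hx)
      exact ⟨a, rfl⟩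
  have hminus : ∀ a, δ a = 0 ↔ γ a ∈ X₀.Aminus := by
    intro a
    rw [hδ_zero]
    constructor
    · intro ha
      choose b hb using ha
      obtain rfl : a = p • b := funext hb
      -- The part of b over V' maps into the socle, so γ(p • b) = p • γ b₂ with γ b₂ in A.
      obtain ⟨b₁, b₂, rfl, h₁, h₂⟩ := hsplit b
      refine h.mem_Aminus.2 ⟨γ b₂, ⟨b₂, h₂, rfl⟩, ?_⟩
      rw [map_smul, map_add, smul_add, (hsoc _).2 ⟨b₁, h₁, rfl⟩, zero_add]
    · intro ha i
      obtain ⟨_, ⟨b, -, rfl⟩, hab⟩ := h.mem_Aminus.1 ha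
      have := hγ_dvd (a - p • b) (by rw [map_sub, map_smul]; exact sub_eq_zero.2 hab.symm) i
      exact (dvd_sub_left (Dvd.intro (b i) rfl)).1 this
  obtain ⟨c, hc⟩ := exists_semilinear_factor γ δ X₀.Aplus hplus
    fun a ha => (hδ_zero a).2 (hγ_dvd a ha)
  have hγ_mem : ∀ a, γ a ∈ X₀.Aplus := fun a => hplus ▸ ⟨a, rfl⟩
  have hrep : ∀ x : X₀.Aplus, ∃ a, x = ⟨γ a, hγ_mem a⟩ := by
    rintro ⟨x, hx⟩
    obtain ⟨a, rfl⟩ : x ∈ LinearMap.range γ := hplus ▸ hx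
    exact ⟨a, rfl⟩
  refine ⟨⟨X₀, hX₀⟩, ⟨c, fun v => ?_, fun x => ?_, fun l hl v => ?_, fun v => ?_, fun v => ?_⟩⟩
  · obtain ⟨a, rfl⟩ := hδ_surj v
    exact ⟨⟨γ a, hγ_mem a⟩, hc a _⟩
  · obtain ⟨a, rfl⟩ := hrep x
    rw [hc]
    exact hminus a
  · constructor
    · intro hv
      have hv' := (hlevel l hl (e.symm v)).1 (by simpa using hv)
      choose a ha using fun i => h.surjective (e.symm v i)
      -- Coordinates of level below l vanish for v; lifting them by 0 makes γ a' divisible by p^l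
      -- inside B.
      let a' : ι → Λ := fun i => if l ≤ lev i then a i else 0
      refine ⟨⟨γ a', hγ_mem a'⟩, ?_, ?_⟩
      · refine mem_heightGE.2 ⟨⟨fun i => p ^ (t i - l) * a' i, (memB _).2 fun i => ?_⟩,
          Subtype.ext (funext fun i => ?_)⟩
        · by_cases hi : l ≤ lev i
          · exact (pow_dvd_pow p (by omega)).mul_right _
          · simp [a', hi]
        · change p ^ l * (p ^ (t i - l) * a' i) = p ^ t i * a' i
          by_cases hi : l ≤ lev i
          · rw [← mul_assoc, ← pow_add, Nat.add_sub_cancel' (hi.trans (hlev_le i))]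
          · simp [a', hi]
      · rw [hc, hδ, ← LinearEquiv.eq_symm_apply]
        funext i
        by_cases hi : l ≤ lev i
        · simp [a', hi, ha]
        · simp [a', hi, (hv' i).resolve_left hi]
    · rintro ⟨x, hx, rfl⟩
      obtain ⟨a, rfl⟩ := hrep x
      rw [hc, hδ, hlevel l hl]
      intro i
      rw [h.map_eq_zero_iff, or_iff_not_imp_left]
      intro hi
      obtain ⟨z, hz⟩ := mem_heightGE.1 hx
      obtain ⟨y, hy⟩ := (memB z.1).1 z.2 i
      have heq : p ^ l * (z : ι → Λ) i = p ^ t i * a i := congrFun (congrArg Subtype.val hz) i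
      have hle := hlev_le i
      -- Elements of p^l B have i-th coordinate in (p^(l + t i - lev i)). As l > lev i, cancelling
      -- p^(t i) modulo p shows p ∣ a i.
      have h0 : p ^ t i * (a i - p ^ (l - lev i) * y) = 0 := by
        rw [mul_sub, ← heq, hy, ← mul_assoc, ← mul_assoc, ← pow_add, ← pow_add,
          show l + (t i - lev i) = t i + (l - lev i) by omega, sub_self]
      have := h.pow_dvd_of_pow_mul_eq_zero (ht_lt i) h0
      rw [pow_one] at this
      exact (dvd_sub_left ((dvd_pow_self p (by omega)).mul_right y)).1 this
  · constructor
    · intro hv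
      obtain ⟨a, rfl⟩ := hδ_surj v
      exact ⟨⟨γ a, hγ_mem a⟩, h.mem_soc.2 ((hsoc _).2 ⟨a, hv, rfl⟩), hc a _⟩
    · rintro ⟨x, hx, rfl⟩
      obtain ⟨a, ha, hax⟩ := (hsoc _).1 (h.mem_soc.1 hx)
      have : x = ⟨γ a, hγ_mem a⟩ := Subtype.ext hax.symm
      rwa [this, hc]
  · constructor
    · intro hv
      obtain ⟨a, rfl⟩ := hδ_surj v
      exact ⟨⟨γ a, hγ_mem a⟩, ⟨a, hv, rfl⟩, hc a _⟩
    · rintro ⟨x, ⟨a, ha, hax⟩, rfl⟩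
      have : x = ⟨γ a, hγ_mem a⟩ := Subtype.ext hax.symm
      rwa [this, hc]

end Density

/-! ### The functor and the equivalence. -/

section Equivalence

variable {Λ : Type u} [CommRing Λ] [IsNoetherianRing Λ] {k : Type w} [Field k] {σ : Λ →+* k}
  {p : Λ} {n : ℕ}

namespace IsUniformizer

/-- The representation of a pair. -/
noncomputable def rep (h : IsUniformizer σ p n) (X : BoundedPair Λ 2) : RepPrime k n :=
  (PairPresentation.exists_rep h X).choose

/-- The identification of the representation of a pair with `A⁺ / A⁻`. -/
noncomputable def presentation (h : IsUniformizer σ p n) (X : BoundedPair Λ 2) :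
    PairPresentation σ p X (h.rep X) :=
  (PairPresentation.exists_rep h X).choose_spec.some

/-- The morphism of representations induced by a morphism of pairs. -/
noncomputable def repMap (h : IsUniformizer σ p n) {X Y : BoundedPair Λ 2} (f : X ⟶ Y) :
    h.rep X ⟶ h.rep Y :=
  ((h.presentation X).exists_map h (h.presentation Y) f).choose

theorem repMap_apply (h : IsUniformizer σ p n) {X Y : BoundedPair Λ 2} (f : X ⟶ Y)
    (a : X.obj.Aplus) : (h.repMap f).hom.1 ((h.presentation X).toMap a) =
      (h.presentation Y).toMap (PairPresentation.mapAplus f a) :=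
  ((h.presentation X).exists_map h (h.presentation Y) f).choose_spec a

/-- The functor `(B; A) ↦ A⁺ / A⁻`. -/
noncomputable def repFunctor (h : IsUniformizer σ p n) : BoundedPair Λ 2 ⥤ RepPrime k n where
  obj := h.rep
  map f := h.repMap f
  map_id X := (h.presentation X).hom_ext fun a => h.repMap_apply (𝟙 X) a
  map_comp {X Y Z} f g := (h.presentation X).hom_ext fun a => by
    rw [h.repMap_apply]
    change _ = (h.repMap g).hom.1 ((h.repMap f).hom.1 ((h.presentation X).toMap a))
    rw [h.repMap_apply, h.repMap_apply]
    rfl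

theorem repMap_add (h : IsUniformizer σ p n) {X Y : BoundedPair Λ 2} (f g : X ⟶ Y) :
    h.repMap (f + g) = h.repMap f + h.repMap g :=
  (h.presentation X).hom_ext fun a => by
    rw [h.repMap_apply]
    change _ = (h.repMap f).hom.1 ((h.presentation X).toMap a) +
      (h.repMap g).hom.1 ((h.presentation X).toMap a)
    rw [h.repMap_apply, h.repMap_apply, ← map_add]
    rfl

/-- A⁺ surjects onto the source and C⁻ is the kernel on the target, so f and g agree exactly when f
- g maps A⁺ into C⁻. -/
theorem repMap_eq_iff (h : IsUniformizer σ p n) {X Y : BoundedPair Λ 2} (f g : X ⟶ Y) :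
    h.repMap f = h.repMap g ↔ BoundedPair.relN Λ f g := by
  have key : ∀ a : X.obj.Aplus, (h.repMap f).hom.1 ((h.presentation X).toMap a) =
      (h.repMap g).hom.1 ((h.presentation X).toMap a) ↔
      SubmodulePair.toLin (f - g).hom (a : X.obj.B) ∈ Y.obj.Aminus := by
    intro a
    rw [h.repMap_apply, h.repMap_apply, PairPresentation.eq_iff]
    rfl
  constructor
  · intro hfg b hb
    exact (key ⟨b, hb⟩).1 (by rw [hfg])
  · intro hfg
    exact (h.presentation X).hom_ext fun a => (key a).2 (hfg _ a.2)

/-- The functor induced on the factor category. -/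
noncomputable def quotientFunctor (h : IsUniformizer σ p n) : S2ModN Λ ⥤ RepPrime k n :=
  CategoryTheory.Quotient.lift (BoundedPair.relN Λ) h.repFunctor fun _ _ f g hfg => (h.repMap_eq_iff f g).2 hfg

instance (h : IsUniformizer σ p n) : h.quotientFunctor.Additive where
  map_add {X Y f g} := by
    obtain ⟨f, rfl⟩ := (Quotient.functor (BoundedPair.relN Λ)).map_surjective f
    obtain ⟨g, rfl⟩ := (Quotient.functor (BoundedPair.relN Λ)).map_surjective g
    exact h.repMap_add f g

instance (h : IsUniformizer σ p n) : h.quotientFunctor.Faithful where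
  map_injective {X Y f g} hfg := by
    obtain ⟨f, rfl⟩ := (Quotient.functor (BoundedPair.relN Λ)).map_surjective f
    obtain ⟨g, rfl⟩ := (Quotient.functor (BoundedPair.relN Λ)).map_surjective g
    exact CategoryTheory.Quotient.sound _ ((h.repMap_eq_iff f g).1 hfg)

instance (h : IsUniformizer σ p n) : h.quotientFunctor.Full where
  map_surjective {X Y} φ := by
    obtain ⟨f, hf⟩ := (h.presentation X.as).exists_lift h (h.presentation Y.as) φ
    exact ⟨(Quotient.functor (BoundedPair.relN Λ)).map f,
      (h.presentation X.as).hom_ext fun a => (h.repMap_apply f a).trans (hf a).symm⟩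

instance (h : IsUniformizer σ p n) : h.quotientFunctor.EssSurj where
  mem_essImage V := by
    obtain ⟨X, ⟨P⟩⟩ := PairPresentation.exists_pair h V
    -- Two presentations of one pair are isomorphic: the identity of X induces mutually inverse
    -- maps.
    obtain ⟨φ, hφ⟩ := (h.presentation X).exists_map h P (𝟙 X)
    obtain ⟨ψ, hψ⟩ := P.exists_map h (h.presentation X) (𝟙 X)
    refine ⟨(Quotient.functor (BoundedPair.relN Λ)).obj X, ⟨⟨φ, ψ, ?_, ?_⟩⟩⟩
    · exact (h.presentation X).hom_ext fun a => (congrArg ψ.hom.1 (hφ a)).trans (hψ _)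
    · exact P.hom_ext fun a => (congrArg φ.hom.1 (hψ a)).trans (hφ _)

theorem additivelyEquivalent (h : IsUniformizer σ p n) :
    AdditivelyEquivalent (S2ModN Λ) (RepPrime k n) :=
  have : h.quotientFunctor.IsEquivalence := {}
  ⟨h.quotientFunctor.asEquivalence, inferInstanceAs h.quotientFunctor.Additive⟩

end IsUniformizer

theorem AdditivelyEquivalent.trans_symm {C : Type*} [Category* C] [Preadditive C] {D : Type*}
    [Category* D] [Preadditive D] {E : Type*} [Category* E] [Preadditive E]
    (hC : AdditivelyEquivalent C E) (hD : AdditivelyEquivalent D E) : AdditivelyEquivalent C D := by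
  obtain ⟨e, he⟩ := hC
  obtain ⟨e', he'⟩ := hD
  have := e'.inverse_additive
  exact ⟨e.trans e'.symm, inferInstanceAs (e.functor ⋙ e'.inverse).Additive⟩

end Equivalence

/-! ### Uniserial rings of finite length and the examples. -/

section Uniserial

variable {R : Type u} [CommRing R]

theorem krullDim_fin_succ (n : ℕ) : Order.krullDim (Fin (n + 1)) = n := by
  refine le_antisymm (iSup_le fun s => ?_) ?_
  · have := s.length_lt_card
    rw [Fintype.card_fin] at this
    exact_mod_cast Nat.lt_succ_iff.1 this
  · exact Order.LTSeries.length_le_krullDim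
      (⟨n, id, fun i => i.castSucc_lt_succ⟩ : LTSeries (Fin (n + 1)))

/-- The ideals are exactly the (p^j) with 0 ≤ j ≤ n, a strict chain of n + 1 members. -/
theorem IsUniformizer.length_eq {k : Type w} [Field k] {σ : R →+* k} {p : R} {n : ℕ}
    (h : IsUniformizer σ p n) : Module.length R R = n := by
  classical
  let g : Fin (n + 1) → (Ideal R)ᵒᵈ := fun j => OrderDual.toDual (Ideal.span {p ^ (j : ℕ)})
  have hg : StrictMono g := by
    intro i j hij
    refine lt_of_le_of_ne (Ideal.span_singleton_le_span_singleton.2 (pow_dvd_pow p hij.le)) ?_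
    intro heq
    have heq' : Ideal.span {p ^ (i : ℕ)} = Ideal.span {p ^ (j : ℕ)} := heq
    obtain ⟨c, hc⟩ := Ideal.span_singleton_le_span_singleton.1 heq'.le
    have hij' : (i : ℕ) < j := hij
    have hj := j.2
    have h0 : p ^ (n - 1) = 0 := by
      rw [show n - 1 = (n - 1 - i) + i by omega, pow_add, hc, ← mul_assoc, ← pow_add,
        pow_eq_zero_of_le (by omega) h.pow_eq_zero, zero_mul]
    exact h.pow_pred_ne_zero h0
  have hsurj : Function.Surjective g := by
    intro I
    have hex : ∃ j, p ^ j ∈ OrderDual.ofDual I := ⟨n, by rw [h.pow_eq_zero]; exact zero_mem _⟩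
    have hle : Nat.find hex ≤ n := Nat.find_min' hex (by rw [h.pow_eq_zero]; exact zero_mem _)
    refine ⟨⟨Nat.find hex, by omega⟩, ?_⟩
    change Ideal.span {p ^ Nat.find hex} = OrderDual.ofDual I
    refine le_antisymm ((Ideal.span_singleton_le_iff_mem _).2 (Nat.find_spec hex)) ?_
    intro x hx
    rw [Ideal.mem_span_singleton]
    rcases eq_or_ne x 0 with rfl | hx0
    · exact dvd_zero _
    obtain ⟨j, u, hu, rfl⟩ := h.exists_eq_pow_mul hx0
    rw [Ideal.mul_unit_mem_iff_mem _ hu] at hx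
    exact (pow_dvd_pow p (Nat.find_min' hex hx)).mul_right u
  have hdim := Order.krullDim_eq_of_orderIso (hg.orderIsoOfSurjective g hsurj)
  rw [Order.krullDim_orderDual] at hdim
  have hlen : (Module.length R R : WithBot ℕ∞) = Order.krullDim (Ideal R) := Module.coe_length R R
  rw [← hdim, krullDim_fin_succ] at hlen
  exact_mod_cast hlen

/-- If 𝔪 = 𝔪², Nakayama gives 𝔪 = 0. Otherwise any p in 𝔪 \ 𝔪² generates: p = yc with y in 𝔪 forces
c to be a unit. -/
theorem IsUniserialRing.exists_maximalIdeal_eq_span [IsLocalRing R] [IsNoetherianRing R]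
    (hR : IsUniserialRing R) : ∃ p : R, IsLocalRing.maximalIdeal R = Ideal.span {p} := by
  by_cases hsq : IsLocalRing.maximalIdeal R ≤
      IsLocalRing.maximalIdeal R • IsLocalRing.maximalIdeal R
  · refine ⟨0, ?_⟩
    rw [Ideal.span_singleton_eq_bot.2 rfl]
    exact Submodule.eq_bot_of_le_smul_of_le_jacobson_bot _ _ (IsNoetherian.noetherian _) hsq
      (IsLocalRing.jacobson_eq_maximalIdeal _ bot_ne_top).ge
  · obtain ⟨p, hp, hp'⟩ := SetLike.not_le_iff_exists.1 hsq
    refine ⟨p, le_antisymm (fun y hy => ?_) ((Ideal.span_singleton_le_iff_mem _).2 hp)⟩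
    rcases hR (Ideal.span {y}) (Ideal.span {p}) with hle | hle
    · exact hle (Ideal.mem_span_singleton_self y)
    · obtain ⟨c, hc⟩ := Ideal.span_singleton_le_span_singleton.1 hle
      by_cases hcu : IsUnit c
      · rw [Ideal.mem_span_singleton, hc, hcu.mul_right_dvd]
      · exact absurd (hc ▸ mul_comm y c ▸ Submodule.smul_mem_smul
          ((IsLocalRing.mem_maximalIdeal c).2 hcu) hy) hp'

/-- Finite length makes R Artinian, so the generator of the maximal ideal is nilpotent; `length_eq`
identifies its nilpotency index with n. -/
theorem IsUniserialRing.exists_isUniformizer [IsLocalRing R] {n : ℕ} (hR : IsUniserialRing R)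
    (hn : Module.length R R = n) {k : Type w} [Field k]
    (e : IsLocalRing.ResidueField R ≃+* k) :
    IsNoetherianRing R ∧ ∃ (σ : R →+* k) (p : R), IsUniformizer σ p n := by
  classical
  obtain ⟨hnoeth, hart⟩ := isFiniteLength_iff_isNoetherian_isArtinian.1
    (Module.length_ne_top_iff.1 (by rw [hn]; exact ENat.natCast_ne_top n))
  have : IsNoetherianRing R := hnoeth
  have : IsArtinianRing R := hart
  refine ⟨hnoeth, ?_⟩
  obtain ⟨p, hp⟩ := hR.exists_maximalIdeal_eq_span
  have hnil : ∃ m, p ^ m = 0 := by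
    obtain ⟨m, hm⟩ := IsArtinianRing.isNilpotent_jacobson_bot (R := R)
    refine ⟨m, ?_⟩
    have hmem := Ideal.pow_mem_pow (Ideal.mem_span_singleton_self p) m
    rw [← hp, ← IsLocalRing.jacobson_eq_maximalIdeal ⊥ bot_ne_top, hm] at hmem
    exact hmem
  have h0 : Nat.find hnil ≠ 0 := fun h0 => by
    have := Nat.find_spec hnil
    rw [h0, pow_zero] at this
    exact one_ne_zero this
  have h : IsUniformizer ((e : _ →+* k).comp (IsLocalRing.residue R)) p (Nat.find hnil) :=
    { surjective := e.surjective.comp IsLocalRing.residue_surjective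
      map_eq_zero_iff := fun a => by
        rw [← Ideal.mem_span_singleton, ← hp, ← IsLocalRing.residue_eq_zero_iff]
        simp
      pos := Nat.pos_of_ne_zero h0
      pow_eq_zero := Nat.find_spec hnil
      pow_pred_ne_zero := Nat.find_min hnil (by omega) }
  obtain rfl : Nat.find hnil = n := by
    have := h.length_eq.symm.trans hn
    exact_mod_cast this
  exact ⟨_, p, h⟩

theorem isUniformizer_zmod {p n : ℕ} [Fact p.Prime] (hn : 0 < n) :
    IsUniformizer (ZMod.castHom (dvd_pow_self p hn.ne') (ZMod p)) (p : ZMod (p ^ n)) n where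
  surjective := ZMod.castHom_surjective _
  map_eq_zero_iff a := by
    have : NeZero (p ^ n) := ⟨pow_ne_zero n (Fact.out : p.Prime).ne_zero⟩
    obtain ⟨m, rfl⟩ := ZMod.natCast_zmod_surjective a
    rw [map_natCast, ZMod.natCast_eq_zero_iff]
    constructor
    · exact fun hm => by exact_mod_cast Nat.cast_dvd_cast (α := ZMod (p ^ n)) hm
    · intro hm
      have h := map_dvd (ZMod.castHom (dvd_pow_self p hn.ne') (ZMod p)) hm
      rw [map_natCast, map_natCast, ZMod.natCast_self, zero_dvd_iff] at h
      exact (ZMod.natCast_eq_zero_iff _ _).1 h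
  pos := hn
  pow_eq_zero := by
    rw [← Nat.cast_pow, ZMod.natCast_self]
  pow_pred_ne_zero := by
    rw [← Nat.cast_pow, Ne, ZMod.natCast_eq_zero_iff]
    rw [Nat.pow_dvd_pow_iff_le_right (Fact.out : p.Prime).one_lt]
    omega

open Polynomial in
theorem isUniformizer_polynomial (k : Type w) [Field k] {n : ℕ} (hn : 0 < n) :
    ∃ σ : k[X] ⧸ Ideal.span {(X : k[X]) ^ n} →+* k,
      IsUniformizer σ (Ideal.Quotient.mk _ X) n := by
  have hker : ∀ a ∈ Ideal.span {(X : k[X]) ^ n}, constantCoeff a = 0 := by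
    intro a ha
    obtain ⟨b, rfl⟩ := Ideal.mem_span_singleton.1 ha
    simp [hn.ne]
  have hpow : ∀ m : ℕ, (Ideal.Quotient.mk (Ideal.span {(X : k[X]) ^ n}) X) ^ m = 0 ↔ n ≤ m := by
    intro m
    rw [← map_pow, Ideal.Quotient.eq_zero_iff_dvd, pow_dvd_pow_iff X_ne_zero not_isUnit_X]
  refine ⟨Ideal.Quotient.lift _ constantCoeff hker, ?_, ?_, hn, (hpow n).2 le_rfl,
    fun h => by have := (hpow _).1 h; omega⟩
  · intro c
    exact ⟨Ideal.Quotient.mk _ (C c), by simp⟩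
  · intro a
    obtain ⟨f, rfl⟩ := Ideal.Quotient.mk_surjective a
    rw [Ideal.Quotient.lift_mk, constantCoeff_apply, ← X_dvd_iff]
    constructor
    · exact fun hf => map_dvd _ hf
    · rintro ⟨b, hb⟩
      obtain ⟨g, rfl⟩ := Ideal.Quotient.mk_surjective b
      rw [← map_mul, Ideal.Quotient.mk_eq_mk_iff_sub_mem, Ideal.mem_span_singleton] at hb
      exact (dvd_sub_left (dvd_mul_right X g)).1 ((dvd_pow_self X hn.ne').trans hb)

end Uniserial

theorem mainTheorem2 :
    (∀ (Λ : Type u) [CommRing Λ] [IsLocalRing Λ] (Δ : Type v) [CommRing Δ] [IsLocalRing Δ]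
        (k : Type w) [Field k] (n : ℕ),
      IsUniserialRing Λ → Module.length Λ Λ = n →
      IsUniserialRing Δ → Module.length Δ Δ = n →
      Nonempty (IsLocalRing.ResidueField Λ ≃+* k) →
      Nonempty (IsLocalRing.ResidueField Δ ≃+* k) →
        AdditivelyEquivalent (S2ModN Λ) (RepPrime k n) ∧
        AdditivelyEquivalent (S2ModN Δ) (RepPrime k n) ∧
        AdditivelyEquivalent (S2ModN Λ) (S2ModN Δ)) ∧
    (∀ (p n : ℕ), p.Prime → 0 < n →
      AdditivelyEquivalent (S2ModN (ZMod (p ^ n)))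
        (S2ModN (Polynomial (ZMod p) ⧸
          Ideal.span {(Polynomial.X : Polynomial (ZMod p)) ^ n}))) := by
  refine ⟨?_, ?_⟩
  · intro Λ _ _ Δ _ _ k _ n hΛ hΛn hΔ hΔn ⟨eΛ⟩ ⟨eΔ⟩
    obtain ⟨_, σ, p, h⟩ := hΛ.exists_isUniformizer hΛn eΛ
    obtain ⟨_, τ, q, h'⟩ := hΔ.exists_isUniformizer hΔn eΔ
    exact ⟨h.additivelyEquivalent, h'.additivelyEquivalent,
      h.additivelyEquivalent.trans_symm h'.additivelyEquivalent⟩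
  · intro p n hp hn
    have : Fact p.Prime := ⟨hp⟩
    have : NeZero (p ^ n) := ⟨pow_ne_zero n hp.ne_zero⟩
    obtain ⟨σ, h⟩ := isUniformizer_polynomial (ZMod p) hn
    -- Both examples have explicit uniformizers over the same field `ZMod p`, so their uniseriality
    -- need not be checked.
    exact (isUniformizer_zmod hn).additivelyEquivalent.trans_symm h.additivelyEquivalent
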